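/- Throughout, $\mathbb T$ is the unit circle in $\mathbb C$, and $M(\mathbb R)$, $M(\mathbb T)$ denote the finite complex Borel measures on $\mathbb R$ and $\mathbb T$. For $\mu\in M(\mathbb R)$ put $\widehat\mu(\xi)=\int_{\mathbb R}e^{-ix\xi}\,d\mu(x)$ and $V_\mu(t)=|\mu|([t,\infty))$, where $|\mu|$ is the total variation measure; for $\mu\in M(\mathbb T)$ put $\widehat\mu(n)=\int_{\mathbb T}\zeta^{-n}\,d\mu(\zeta)$, $n\in\mathbb Z$, and let $\operatorname{supp}\mu$ be the closed support of $|\mu|$. The logarithm takes the value $\log 0=-\infty$. (a) (Beurling) Let $\mu\in M(\mathbb R)$ satisfy $$\int_0^\infty\frac{\log V_\mu(t)}{1+t^2}\,dt=-\infty .$$ If $\widehat\mu$ vanishes on a set of positive Lebesgue measure in $\mathbb R$, then $\mu=0$. (b) (Cartwright–Levinson) Let $(w(n))_{n\ge1}$ be a non-decreasing sequence of positive real numbers with $\sum_{n\ge1}w(n)/n^2=+\infty$, and let $\mu\in M(\mathbb T)$ satisfy $\widehat\mu(n)=\mathcal O(e^{-w(|n|)})$ as $n\to-\infty$, or $\widehat\mu(n)=\mathcal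 O(e^{-w(|n|)})$ as $n\to+\infty$. Then $\operatorname{supp}\mu=\mathbb T$, unless $\mu=0$. -/

import Mathlib

open Filter Topology MeasureTheory Set Asymptotics

noncomputable section

namespace OneSidedDecay

/-- The integral `∫ f dμ` of a complex-valued function against a complex measure. -/
def cintegral {X : Type*} [MeasurableSpace X] (μ : ComplexMeasure X) (f : X → ℂ) : ℂ :=
  VectorMeasure.integral μ f (ContinuousLinearMap.mul ℝ ℂ)

instance circleMeasurableSpace : MeasurableSpace Circle := borel Circle

instance circleBorelSpace : BorelSpace Circle := ⟨rfl⟩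

/-- The Fourier transform `ξ ↦ ∫ e^{-ixξ} dμ(x)` of a complex Borel measure on the line. -/
def fourierReal (μ : ComplexMeasure ℝ) (ξ : ℝ) : ℂ :=
  cintegral μ fun x : ℝ => Complex.exp (-(Complex.I * (x : ℂ) * (ξ : ℂ)))

/-- The Fourier coefficients `n ↦ ∫ ζ^{-n} dμ(ζ)` of a complex Borel measure on the unit circle. -/
def fourierCircle (μ : ComplexMeasure Circle) (n : ℤ) : ℂ :=
  cintegral μ fun ζ : Circle => (ζ : ℂ) ^ (-n)

/-- The tail `V_μ(t) = |μ|([t, ∞))`, with `|μ|` the total variation measure. -/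
def tailVariation (μ : ComplexMeasure ℝ) (t : ℝ) : ENNReal :=
  VectorMeasure.variation μ (Ici t)

/-- `∫ f dν = -∞` for an extended-real-valued `f`: the integral of the positive part is finite
and the integral of the negative part is infinite. -/
def IntegralEqNegInfty {X : Type*} [MeasurableSpace X] (ν : Measure X) (f : X → EReal) : Prop :=
  (∫⁻ x, (f x).toENNReal ∂ν) < ⊤ ∧ (∫⁻ x, (-(f x)).toENNReal ∂ν) = ⊤

/-- The closed support of a complex Borel measure on the unit circle, that is, the support of its
total variation measure. -/
def csupport (μ : ComplexMeasure Circle) : Set Circle :=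
  (VectorMeasure.variation μ).support

end OneSidedDecay

end

namespace OneSidedDecay

/-! Beurling's theorem. Write μ = h dν with ν = |μ| and |h| ≤ 1, and let F_T be the transform of μ
restricted to (-∞, T). It extends holomorphically to the upper half-plane, where e^{iTz} F_T(z) is
bounded by the mass of ν. Where the full transform vanishes, |F_T| ≤ ν([T, ∞)) ≤ M e^{-l} on the
real line. Near a density point x₀ of the zero set, the two constants theorem turns this into |F_T(x
+ iy)| ≲ e^{-Ty} in a rectangle whose sides are comparable to l/T (`smallNear_of_volume_ge`). This
exponential gain in y is the quantity that propagates.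

Take scales T_n, l_n growing geometrically. If F_{T_{n+1}} is small over an interval around x₀, then
so is F_{T_n} at height l_n/(4 T_{n+1}), because the two differ there by at most M e^{-3 l_n/4}.
Harmonic measure then widens the interval by a fixed multiple of l_n/T_n on each side
(`SmallNear.step`). Descending from n + d to n adds the widenings, and the divergence of ∑ l_n/T_n,
which is the divergence of the logarithmic integral, makes F_{T_n} small over the whole line.
Evaluating at ξ + im/T_n and letting n, then m, tend to infinity gives a zero transform everywhere
(`integral_eq_zero_of_sequences`), so μ = 0 by uniqueness.

The Cartwright–Levinson theorem follows by duality. If |μ| has no mass on an open set U, multiply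
the coefficients of μ by those of a narrow triangular bump. The resulting absolutely convergent
series is the convolution of μ with the bump, which vanishes on an interval inside U. It is also the
transform of a measure on ℤ ⊂ ℝ with a small tail on one side, so Beurling's theorem kills all its
coefficients (`coeff_eq_zero_of_decay`, `moment_eq_zero`). -/

/-! ### Phragmén–Lindelöf estimates in the half-plane and in a strip. -/

theorem norm_le_of_upper_half_plane {f : ℂ → ℂ} {B C : ℝ}
    (hd : DiffContOnCl ℂ f {z | 0 < z.im}) (hB : ∀ z : ℂ, 0 < z.im → ‖f z‖ ≤ B)
    (hC : ∀ x : ℝ, ‖f x‖ ≤ C) {z : ℂ} (hz : 0 ≤ z.im) : ‖f z‖ ≤ C := by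
  have hmap : MapsTo (fun z : ℂ => Complex.I * z) {z | 0 < z.re} {z | 0 < z.im} := by
    intro z hz
    simpa using hz
  have hd' : DiffContOnCl ℂ (fun z => f (Complex.I * z)) {z | 0 < z.re} :=
    DiffContOnCl.comp hd
      ((differentiable_id.const_mul Complex.I).diffContOnCl (s := {z : ℂ | 0 < z.re})) hmap
  have key := PhragmenLindelof.right_half_plane_of_bounded_on_real (C := C)
    (f := fun z => f (Complex.I * z)) (z := -Complex.I * z) hd' ?_ ?_ ?_ ?_
  · simpa [← mul_assoc] using key
  · refine ⟨0, by norm_num, 0, ?_⟩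
    refine IsBigO.of_bound B ?_
    refine eventually_inf_principal.2 (Eventually.of_forall fun w hw => ?_)
    have : 0 < (Complex.I * w).im := hmap hw
    simpa using hB _ this
  · refine ⟨B, ?_⟩
    rw [eventually_map]
    filter_upwards [eventually_gt_atTop 0] with x hx
    exact hB _ (by simpa using hx)
  · intro x
    have h := hC (-x)
    have e : Complex.I * ((x : ℂ) * Complex.I) = ((-x : ℝ) : ℂ) := by
      rw [mul_comm (x : ℂ), ← mul_assoc, Complex.I_mul_I]; push_cast; ring
    rw [e]; exact h
  · simpa using hz

/-- An explicit cubic harmonic polynomial s replaces harmonic measure. It vanishes on the real line,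
is at most 3H/2 in the strip, is nonpositive on the top side where |x - t₀| ≥ H, and is at least y/2
where |x - t₀| ≤ H/2. With a = 2A/(3H), the function g · exp(a p), where Re p = s, has modulus at
most 1 on both sides of the strip. -/
theorem norm_le_exp_of_strip {g : ℂ → ℂ} {H A t₀ : ℝ} (hH : 0 < H) (hA : 0 ≤ A)
    (hd : DiffContOnCl ℂ g {z | 0 < z.im})
    (h1 : ∀ z : ℂ, 0 ≤ z.im → ‖g z‖ ≤ 1)
    (h2 : ∀ x : ℝ, |x - t₀| ≤ H → ‖g (x + H * Complex.I)‖ ≤ Real.exp (-A))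
    {x y : ℝ} (hx : |x - t₀| ≤ H / 2) (hy0 : 0 ≤ y) (hy : y ≤ H) :
    ‖g (x + y * Complex.I)‖ ≤ Real.exp (-(A * y / (3 * H))) := by
  set a : ℝ := 2 * A / (3 * H) with ha
  have ha0 : 0 ≤ a := by positivity
  let p : ℂ → ℂ := fun z => -Complex.I * ((z - t₀) - (z - t₀) ^ 3 / (2 * H ^ 2))
  let s : ℝ → ℝ → ℝ := fun x y => y * (1 + (y ^ 2 - 3 * (x - t₀) ^ 2) / (2 * H ^ 2))
  have hp : ∀ x y : ℝ, (p (x + y * Complex.I)).re = s x y := by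
    intro x y
    have e : p (x + y * Complex.I) =
        ((s x y : ℝ) : ℂ) + (((-(x - t₀) + ((x - t₀) ^ 3 - 3 * (x - t₀) * y ^ 2) / (2 * H ^ 2) : ℝ)) : ℂ)
          * Complex.I := by
      have hHc : (H : ℂ) ≠ 0 := by exact_mod_cast hH.ne'
      simp only [p, s]
      push_cast
      field_simp
      ring_nf
      simp only [Complex.I_sq, show Complex.I ^ 3 = -Complex.I by
        rw [pow_succ, Complex.I_sq]; ring, show Complex.I ^ 4 = 1 by
        rw [show (4 : ℕ) = 2 * 2 from rfl, pow_mul, Complex.I_sq]; ring]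
      ring
    rw [e, Complex.add_re, Complex.ofReal_re, Complex.re_ofReal_mul, Complex.I_re, mul_zero, add_zero]
  have hs_le : ∀ x y, 0 ≤ y → y ≤ H → s x y ≤ 3 * H / 2 := by
    intro x y h0 h1
    have : (y ^ 2 - 3 * (x - t₀) ^ 2) / (2 * H ^ 2) ≤ 1 / 2 := by
      rw [div_le_iff₀ (by positivity)]
      nlinarith [sq_nonneg (x - t₀)]
    simp only [s]
    nlinarith
  let F : ℂ → ℂ := fun z => g z * Complex.exp (a * p z)
  have hF : ∀ x y : ℝ, ‖F (x + y * Complex.I)‖ = ‖g (x + y * Complex.I)‖ * Real.exp (a * s x y) := by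
    intro x y
    simp only [F, norm_mul, Complex.norm_exp, Complex.re_ofReal_mul, hp]
  have hFz : ∀ z : ℂ, ‖F z‖ = ‖g z‖ * Real.exp (a * s z.re z.im) := by
    intro z
    have := hF z.re z.im
    rwa [Complex.re_add_im] at this
  have hsub : Complex.im ⁻¹' Ioo 0 H ⊆ {z : ℂ | 0 < z.im} := fun z hz => hz.1
  have hFd : DiffContOnCl ℂ F (Complex.im ⁻¹' Ioo 0 H) := by
    refine DiffContOnCl.smul (hd.mono hsub) (Differentiable.diffContOnCl ?_)
    simp only [p]
    fun_prop
  have hz1 : ‖F (x + y * Complex.I)‖ ≤ 1 := by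
    refine PhragmenLindelof.horizontal_strip (a := 0) (b := H) hFd ⟨0, by positivity, 0, ?_⟩ ?_ ?_
      (by simpa using hy0) (by simpa using hy)
    · refine IsBigO.of_bound (Real.exp (a * (3 * H / 2))) ?_
      refine eventually_inf_principal.2 (Eventually.of_forall fun w hw => ?_)
      rw [hFz]
      have h3 : Real.exp (a * s w.re w.im) ≤ Real.exp (a * (3 * H / 2)) := by
        gcongr; exact hs_le _ _ hw.1.le hw.2.le
      have h4 := h1 w hw.1.le
      have : ‖g w‖ * Real.exp (a * s w.re w.im) ≤ 1 * Real.exp (a * (3 * H / 2)) := by gcongr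
      simpa using this
    · intro z hz
      rw [hFz, hz]
      simpa [s] using h1 z hz.ge
    · intro z hz
      rw [hFz]
      by_cases hc : |z.re - t₀| ≤ H
      · have h3 := h2 z.re hc
        rw [← hz, Complex.re_add_im] at h3
        have h4 : a * s z.re z.im ≤ A := by
          calc a * s z.re z.im ≤ a * (3 * H / 2) := by
                gcongr; exact hs_le _ _ (by rw [hz]; exact hH.le) hz.le
            _ = A := by rw [ha]; field_simp
        calc _ ≤ Real.exp (-A) * Real.exp A := by gcongr
          _ = 1 := by rw [← Real.exp_add]; simp
      · have h3 : s z.re z.im ≤ 0 := by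
          simp only [s, hz]
          refine mul_nonpos_of_nonneg_of_nonpos hH.le ?_
          have : H ^ 2 ≤ (z.re - t₀) ^ 2 := by
            rw [← sq_abs (z.re - t₀)]; push Not at hc; gcongr
          have : (H ^ 2 - 3 * (z.re - t₀) ^ 2) / (2 * H ^ 2) ≤ -1 := by
            rw [div_le_iff₀ (by positivity)]; linarith
          linarith
        have h4 : Real.exp (a * s z.re z.im) ≤ 1 := by
          rw [Real.exp_le_one_iff]; exact mul_nonpos_of_nonneg_of_nonpos ha0 h3
        have h5 := h1 z (by rw [hz]; exact hH.le)
        exact mul_le_one₀ h5 (Real.exp_nonneg _) h4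
  rw [hF] at hz1
  have hs2 : y / 2 ≤ s x y := by
    have h5 : (x - t₀) ^ 2 ≤ (H / 2) ^ 2 := by rw [← sq_abs (x - t₀)]; gcongr
    have : (-1 / 2 : ℝ) ≤ (y ^ 2 - 3 * (x - t₀) ^ 2) / (2 * H ^ 2) := by
      rw [le_div_iff₀ (by positivity)]; nlinarith [sq_nonneg y, sq_nonneg H]
    simp only [s]; nlinarith
  have h6 : A * y / (3 * H) ≤ a * s x y := by
    calc A * y / (3 * H) = a * (y / 2) := by rw [ha]; field_simp
      _ ≤ _ := by gcongr
  calc ‖g (x + y * Complex.I)‖ = (‖g (x + y * Complex.I)‖ * Real.exp (a * s x y)) *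
        Real.exp (-(a * s x y)) := by rw [mul_assoc, ← Real.exp_add]; simp
    _ ≤ 1 * Real.exp (-(A * y / (3 * H))) := by gcongr
    _ = _ := one_mul _

/-! ### Poisson integrals and the two constants theorem. -/

/-- The Poisson integral over the real line of `φ` at the point `x + iy`. -/
noncomputable def poissonIntegral (φ : ℝ → ℝ) (x y : ℝ) : ℝ :=
  Real.pi⁻¹ * ∫ t, φ t * (y / ((x - t) ^ 2 + y ^ 2))

/-- The holomorphic function on the upper half-plane whose real part is the Poisson integral. -/
noncomputable def cauchyTransform (φ : ℝ → ℝ) (ζ : ℂ) : ℂ :=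
  (Real.pi * Complex.I)⁻¹ * ∫ t : ℝ, (φ t : ℂ) * ((t : ℂ) - ζ)⁻¹

theorem ofReal_sub_ne_zero_of_im_pos {ζ : ℂ} (hζ : 0 < ζ.im) (t : ℝ) : (t : ℂ) - ζ ≠ 0 := by
  intro h
  have := congrArg Complex.im h
  simp at this
  exact hζ.ne' this

theorem im_le_norm_ofReal_sub (ζ : ℂ) (t : ℝ) : ζ.im ≤ ‖(t : ℂ) - ζ‖ := by
  have := Complex.abs_im_le_norm ((t : ℂ) - ζ)
  simp at this
  exact (le_abs_self _).trans this

theorem integrable_cauchy_kernel {φ : ℝ → ℝ} (hφ : Continuous φ) (hc : HasCompactSupport φ)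
    {ζ : ℂ} (hζ : 0 < ζ.im) : Integrable fun t : ℝ => (φ t : ℂ) * ((t : ℂ) - ζ)⁻¹ := by
  refine Continuous.integrable_of_hasCompactSupport ?_ ?_
  · exact (Complex.continuous_ofReal.comp hφ).mul
      ((Complex.continuous_ofReal.sub continuous_const).inv₀ (ofReal_sub_ne_zero_of_im_pos hζ))
  · exact HasCompactSupport.mul_right (f := fun t => (φ t : ℂ))
      (hc.comp_left (g := fun r : ℝ => (r : ℂ)) (by simp))

theorem differentiableAt_cauchyTransform {φ : ℝ → ℝ} (hφ : Continuous φ)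
    (hc : HasCompactSupport φ) {ζ : ℂ} (hζ : 0 < ζ.im) :
    DifferentiableAt ℂ (cauchyTransform φ) ζ := by
  have hball : ∀ w ∈ Metric.ball ζ (ζ.im / 2), ζ.im / 2 < w.im := by
    intro w hw
    have h1 : |(w - ζ).im| ≤ ‖w - ζ‖ := Complex.abs_im_le_norm _
    rw [Metric.mem_ball, dist_eq_norm] at hw
    have h2 := (abs_lt.1 (h1.trans_lt hw)).1
    simp at h2
    linarith
  have h2 : 0 < ζ.im / 2 := by positivity
  have hint : Integrable φ := hφ.integrable_of_hasCompactSupport hc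
  have key := hasDerivAt_integral_of_dominated_loc_of_deriv_le (μ := (volume : Measure ℝ))
    (F := fun (w : ℂ) (t : ℝ) => (φ t : ℂ) * ((t : ℂ) - w)⁻¹)
    (F' := fun (w : ℂ) (t : ℝ) => (φ t : ℂ) * (((t : ℂ) - w) ^ 2)⁻¹)
    (x₀ := ζ) (s := Metric.ball ζ (ζ.im / 2)) (bound := fun t => |φ t| * ((ζ.im / 2) ^ 2)⁻¹)
    (Metric.ball_mem_nhds _ h2) ?_ (integrable_cauchy_kernel hφ hc hζ) ?_ ?_ ?_ ?_
  · exact (key.2.differentiableAt).const_mul _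
  · filter_upwards [Metric.ball_mem_nhds ζ h2] with w hw
    exact (integrable_cauchy_kernel hφ hc (h2.trans (hball w hw))).aestronglyMeasurable
  · refine Measurable.aestronglyMeasurable ?_
    have := hφ.measurable
    fun_prop
  · refine Eventually.of_forall fun t w hw => ?_
    rw [norm_mul, norm_inv, norm_pow, Complex.norm_real, Real.norm_eq_abs]
    have := (hball w hw).le.trans (im_le_norm_ofReal_sub w t)
    gcongr
  · exact hint.abs.mul_const _
  · refine Eventually.of_forall fun t w hw => ?_
    have hne := ofReal_sub_ne_zero_of_im_pos (h2.trans (hball w hw)) t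
    have h3 := (((hasDerivAt_id w).const_sub (t : ℂ)).fun_inv hne).const_mul (φ t : ℂ)
    simpa using h3

theorem re_cauchyTransform {φ : ℝ → ℝ} (hφ : Continuous φ) (hc : HasCompactSupport φ)
    {ζ : ℂ} (hζ : 0 < ζ.im) : (cauchyTransform φ ζ).re = poissonIntegral φ ζ.re ζ.im := by
  rw [cauchyTransform, poissonIntegral, mul_inv, mul_assoc, ← integral_const_mul,
    ← Complex.ofReal_inv, Complex.re_ofReal_mul]
  congr 1
  have hi : Integrable fun t : ℝ => Complex.I⁻¹ * ((φ t : ℂ) * ((t : ℂ) - ζ)⁻¹) :=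
    (integrable_cauchy_kernel hφ hc hζ).const_mul _
  have := integral_re hi
  simp only [RCLike.re_to_complex] at this
  rw [← this]
  congr 1 with t
  rw [mul_left_comm, Complex.re_ofReal_mul]
  congr 1
  rw [Complex.inv_I]
  simp [Complex.inv_re, Complex.inv_im, Complex.normSq_apply]
  ring

theorem poissonIntegral_eq {φ : ℝ → ℝ} (x : ℝ) {y : ℝ} (hy : 0 < y) :
    poissonIntegral φ x y = Real.pi⁻¹ * ∫ s, (1 + s ^ 2)⁻¹ * φ (x - y * s) := by
  rw [poissonIntegral]
  congr 1
  rw [← integral_sub_left_eq_self (fun t => φ t * (y / ((x - t) ^ 2 + y ^ 2))) volume x]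
  have h := Measure.integral_comp_mul_left
    (fun t => φ (x - t) * (y / ((x - (x - t)) ^ 2 + y ^ 2))) y
  rw [abs_of_pos (inv_pos.2 hy), smul_eq_mul, eq_comm, inv_mul_eq_iff_eq_mul₀ hy.ne'] at h
  rw [h, ← integral_const_mul]
  congr 1 with s
  have : (0 : ℝ) < 1 + s ^ 2 := by positivity
  field_simp
  ring

theorem integrable_inv_one_add_sq_mul {ψ : ℝ → ℝ} (hψ : Measurable ψ) {C : ℝ}
    (h : ∀ s, |ψ s| ≤ C) : Integrable fun s : ℝ => (1 + s ^ 2)⁻¹ * ψ s :=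
  integrable_inv_one_add_sq.mul_bdd (c := C) hψ.aestronglyMeasurable
    (Eventually.of_forall fun s => by simpa using h s)

theorem poissonIntegral_le_one {φ : ℝ → ℝ} (hφ : Measurable φ) (h0 : ∀ t, 0 ≤ φ t)
    (h1 : ∀ t, φ t ≤ 1) (x : ℝ) {y : ℝ} (hy : 0 < y) : poissonIntegral φ x y ≤ 1 := by
  rw [poissonIntegral_eq x hy, inv_mul_le_iff₀ Real.pi_pos, mul_one]
  rw [← integral_univ_inv_one_add_sq]
  refine integral_mono (integrable_inv_one_add_sq_mul (C := 1) (by fun_prop)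
    fun s => ?_) integrable_inv_one_add_sq fun s => ?_
  · rw [abs_of_nonneg (h0 _)]; exact h1 _
  · have : (0 : ℝ) < (1 + s ^ 2)⁻¹ := by positivity
    exact mul_le_of_le_one_right this.le (h1 _)

theorem tendsto_integral_tail (δ : ℝ) (hδ : 0 < δ) :
    Tendsto (fun η : ℝ => ∫ s : ℝ, (1 + s ^ 2)⁻¹ * (if δ ≤ η * |s| then 1 else 0))
      (𝓝[>] 0) (𝓝 0) := by
  suffices h : Tendsto (fun η : ℝ => ∫ s : ℝ, (1 + s ^ 2)⁻¹ * (if δ ≤ η * |s| then 1 else 0))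
      (𝓝[>] 0) (𝓝 (∫ _ : ℝ, (0 : ℝ))) by simpa using h
  refine tendsto_integral_filter_of_dominated_convergence (fun s => (1 + s ^ 2)⁻¹) ?_ ?_
    integrable_inv_one_add_sq ?_
  · refine Eventually.of_forall fun η => Measurable.aestronglyMeasurable ?_
    refine Measurable.mul (by fun_prop) (Measurable.ite ?_ measurable_const measurable_const)
    exact measurableSet_le measurable_const (by fun_prop)
  · refine Eventually.of_forall fun η => Eventually.of_forall fun s => ?_
    have : (0 : ℝ) < (1 + s ^ 2)⁻¹ := by positivity
    split_ifs
    · rw [mul_one, Real.norm_eq_abs, abs_of_pos this]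
    · simpa using this.le
  · refine Eventually.of_forall fun s => ?_
    have ht : Tendsto (fun η : ℝ => η * |s|) (𝓝[>] 0) (𝓝 0) := by
      have : Tendsto (fun η : ℝ => η * |s|) (𝓝 0) (𝓝 (0 * |s|)) :=
        (continuous_id.mul continuous_const).tendsto 0
      simpa using this.mono_left nhdsWithin_le_nhds
    have he : ∀ᶠ η in 𝓝[>] (0 : ℝ),
        0 = (1 + s ^ 2)⁻¹ * (if δ ≤ η * |s| then (1 : ℝ) else 0) := by
      filter_upwards [ht.eventually (gt_mem_nhds hδ)] with η hη
      rw [if_neg (not_le.2 hη), mul_zero]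
    exact tendsto_const_nhds.congr' he

/-- The Poisson kernel is an approximate identity. Uniformity in x matters, because the bound serves
on an entire horizontal line at once. -/
theorem eventually_poissonIntegral_le {φ : ℝ → ℝ} (hφ : UniformContinuous φ)
    (h0 : ∀ t, 0 ≤ φ t) (h1 : ∀ t, φ t ≤ 1) {ε : ℝ} (hε : 0 < ε) :
    ∀ᶠ η in 𝓝[>] (0 : ℝ), ∀ x, poissonIntegral φ x η ≤ φ x + ε := by
  obtain ⟨δ, hδ, hd⟩ := Metric.uniformContinuous_iff.1 hφ (ε / 2) (by positivity)
  filter_upwards [self_mem_nhdsWithin, (tendsto_integral_tail δ hδ).eventually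
    (gt_mem_nhds (show (0 : ℝ) < ε / 2 by positivity))] with η hη hη2 x
  have hη : 0 < η := hη
  rw [poissonIntegral_eq x hη, inv_mul_le_iff₀ Real.pi_pos]
  have hm : Measurable φ := hφ.continuous.measurable
  set D : ℝ → ℝ := fun s => if δ ≤ η * |s| then 1 else 0 with hD
  have hDm : Measurable D :=
    Measurable.ite (measurableSet_le measurable_const (by fun_prop)) measurable_const
      measurable_const
  have hDi : Integrable fun s : ℝ => (1 + s ^ 2)⁻¹ * D s :=
    integrable_inv_one_add_sq_mul (C := 1) hDm fun s => by simp only [hD]; split_ifs <;> simp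
  have hpt : ∀ s, φ (x - η * s) ≤ φ x + ε / 2 + D s := by
    intro s
    by_cases hs : δ ≤ η * |s|
    · simp only [hD, if_pos hs]; linarith [h1 (x - η * s), h0 x]
    · simp only [hD, if_neg hs]
      have : dist (x - η * s) x < δ := by
        rw [Real.dist_eq, sub_sub_cancel_left, abs_neg, abs_mul, abs_of_pos hη]
        exact not_le.1 hs
      have := hd this
      rw [Real.dist_eq] at this
      linarith [(abs_lt.1 this).2]
  calc ∫ s, (1 + s ^ 2)⁻¹ * φ (x - η * s)
      ≤ ∫ s, ((1 + s ^ 2)⁻¹ * (φ x + ε / 2) + (1 + s ^ 2)⁻¹ * D s) := by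
        refine integral_mono (integrable_inv_one_add_sq_mul (C := 1) (by fun_prop) fun s => ?_)
          ((integrable_inv_one_add_sq.mul_const _).add hDi) fun s => ?_
        · rw [abs_of_nonneg (h0 _)]; exact h1 _
        · have : (0 : ℝ) < (1 + s ^ 2)⁻¹ := by positivity
          change (1 + s ^ 2)⁻¹ * φ (x - η * s) ≤
            (1 + s ^ 2)⁻¹ * (φ x + ε / 2) + (1 + s ^ 2)⁻¹ * D s
          rw [← mul_add]
          exact mul_le_mul_of_nonneg_left (hpt s) this.le
    _ = Real.pi * (φ x + ε / 2) + ∫ s, (1 + s ^ 2)⁻¹ * D s := by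
        rw [integral_add (integrable_inv_one_add_sq.mul_const _) hDi, integral_mul_const,
          integral_univ_inv_one_add_sq]
    _ ≤ Real.pi * (φ x + ε / 2) + ε / 2 := by gcongr
    _ ≤ Real.pi * (φ x + ε) := by nlinarith [Real.pi_gt_three]

/-- **Two constants theorem** for the upper half-plane. -/
theorem norm_le_exp_of_upper_half_plane {g : ℂ → ℂ} (hd : DiffContOnCl ℂ g {z | 0 < z.im})
    (h1 : ∀ z : ℂ, 0 ≤ z.im → ‖g z‖ ≤ 1) {E : Set ℝ} (hE : MeasurableSet E) {a b : ℝ}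
    (hEb : E ⊆ Icc a b) {A : ℝ} (hA : 0 ≤ A) (hgE : ∀ t ∈ E, ‖g t‖ ≤ Real.exp (-A))
    (x : ℝ) {y : ℝ} (hy : 0 < y) :
    ‖g (x + y * Complex.I)‖ ≤
      Real.exp (-(A * (Real.pi⁻¹ * ∫ t in E, y / ((x - t) ^ 2 + y ^ 2)))) := by
  rcases hA.eq_or_lt with rfl | hA
  · simpa using h1 _ (by simpa using hy.le)
  have hg : Continuous fun t : ℝ => ‖g t‖ := by
    refine continuous_norm.comp (hd.continuousOn.comp_continuous Complex.continuous_ofReal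
      fun t => ?_)
    rw [Complex.closure_setOfPred_lt_im]
    simp
  -- The floor `exp (-A)` keeps the logarithm continuous and puts `-log m / A` between 0 and 1, with
  -- value 1 on E. The cutoff χ, equal to 1 on [a, b], then makes φ compactly supported.
  set m : ℝ → ℝ := fun t => max ‖g t‖ (Real.exp (-A)) with hm
  have hm0 : ∀ t, 0 < m t := fun t => (Real.exp_pos _).trans_le (le_max_right _ _)
  have hm1 : ∀ t, m t ≤ 1 := fun t => max_le (h1 _ (by simp)) (by simpa using hA.le)
  set χ : ℝ → ℝ := fun t => max 0 (min 1 (min (t - a + 1) (b + 1 - t))) with hχ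
  have hχ0 : ∀ t, 0 ≤ χ t := fun t => le_max_left _ _
  have hχ1 : ∀ t, χ t ≤ 1 := fun t => max_le zero_le_one (min_le_left _ _)
  set φ : ℝ → ℝ := fun t => χ t * (-Real.log (m t) / A) with hφ
  have hl0 : ∀ t, 0 ≤ -Real.log (m t) / A := fun t =>
    div_nonneg (neg_nonneg.2 (Real.log_nonpos (hm0 t).le (hm1 t))) hA.le
  have hl1 : ∀ t, -Real.log (m t) / A ≤ 1 := fun t => by
    rw [div_le_one hA, neg_le, ← Real.log_exp (-A)]
    exact Real.log_le_log (Real.exp_pos _) (le_max_right _ _)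
  have hφ0 : ∀ t, 0 ≤ φ t := fun t => mul_nonneg (hχ0 t) (hl0 t)
  have hφ1 : ∀ t, φ t ≤ 1 := fun t => mul_le_one₀ (hχ1 t) (hl0 t) (hl1 t)
  have hφc : Continuous φ := by
    refine Continuous.mul (by fun_prop) (Continuous.div_const (Continuous.neg ?_) _)
    exact Continuous.log (by fun_prop) fun t => (hm0 t).ne'
  have hφs : HasCompactSupport φ := by
    refine HasCompactSupport.intro (K := Icc (a - 1) (b + 1)) isCompact_Icc fun t ht => ?_
    have : χ t = 0 := by
      simp only [hχ]
      refine max_eq_left ?_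
      by_contra hcon
      push Not at hcon
      have h1 := (lt_min_iff.1 hcon).2
      have h2 := lt_min_iff.1 h1
      exact ht ⟨by linarith, by linarith⟩
    simp [hφ, this]
  have hφE : ∀ t ∈ E, φ t = 1 := by
    intro t ht
    have h2 := hEb ht
    have h3 : χ t = 1 := by
      simp only [hχ]
      rw [min_eq_left (le_min (by linarith [h2.1]) (by linarith [h2.2])), max_eq_right zero_le_one]
    have h4 : m t = Real.exp (-A) := max_eq_right (hgE t ht)
    simp only [hφ, h3, h4, Real.log_exp]
    field_simp
  have hgφ : ∀ t : ℝ, ‖g t‖ * Real.exp (A * φ t) ≤ 1 := by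
    intro t
    have h2 : A * φ t ≤ -Real.log (m t) := by
      calc A * φ t ≤ A * (-Real.log (m t) / A) := by
            gcongr; exact mul_le_of_le_one_left (hl0 t) (hχ1 t)
        _ = _ := by field_simp
    calc ‖g t‖ * Real.exp (A * φ t) ≤ m t * Real.exp (-Real.log (m t)) := by
          gcongr; exact le_max_left _ _
      _ = 1 := by rw [Real.exp_neg, Real.exp_log (hm0 t)]; exact mul_inv_cancel₀ (hm0 t).ne'
  have hu := hφs.uniformContinuous_of_continuous hφc
  have hline : ∀ ε : ℝ, 0 < ε → ∀ᶠ η in 𝓝[>] (0 : ℝ),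
      ‖g (x + y * Complex.I)‖ * Real.exp (A * poissonIntegral φ x (y + η)) ≤ Real.exp (A * ε) := by
    intro ε hε
    filter_upwards [self_mem_nhdsWithin, eventually_poissonIntegral_le hu hφ0 hφ1 hε] with η hη hη2
    have hη : 0 < η := hη
    -- Raising the argument by η avoids boundary values of the Cauchy transform; the price is the
    -- factor `exp (A * ε)` on the real line, removed by η → 0 and then ε → 0.
    let G : ℂ → ℂ := fun z => g z * Complex.exp (A * cauchyTransform φ (z + η * Complex.I))
    have hG : ∀ z : ℂ, 0 ≤ z.im →
        ‖G z‖ = ‖g z‖ * Real.exp (A * poissonIntegral φ z.re (z.im + η)) := by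
      intro z hz
      simp only [G]
      rw [norm_mul, Complex.norm_exp, Complex.re_ofReal_mul, re_cauchyTransform hφc hφs]
      · simp
      · simp; linarith
    have hGd : DiffContOnCl ℂ G {z | 0 < z.im} := by
      refine DiffContOnCl.smul hd (DifferentiableOn.diffContOnCl fun z hz => ?_)
      rw [Complex.closure_setOfPred_lt_im] at hz
      have hz : 0 ≤ z.im := hz
      refine DifferentiableAt.differentiableWithinAt ?_
      have : DifferentiableAt ℂ (fun z : ℂ => cauchyTransform φ (z + η * Complex.I)) z := by
        refine DifferentiableAt.comp z (g := cauchyTransform φ)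
          (differentiableAt_cauchyTransform hφc hφs ?_) (by fun_prop)
        simp; linarith
      fun_prop
    have hle := norm_le_of_upper_half_plane (B := Real.exp A) (C := Real.exp (A * ε)) hGd
      (fun z hz => ?_) (fun t => ?_) (z := x + y * Complex.I) (by simpa using hy.le)
    · rw [hG _ (by simpa using hy.le)] at hle
      simpa using hle
    · rw [hG z hz.le]
      have h3 := poissonIntegral_le_one hφc.measurable hφ0 hφ1 z.re (add_pos hz hη)
      have h4 := h1 z hz.le
      calc ‖g z‖ * Real.exp (A * poissonIntegral φ z.re (z.im + η)) ≤ 1 * Real.exp (A * 1) := by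
            gcongr
        _ = Real.exp A := by simp
    · rw [hG _ (by simp)]
      simp only [Complex.ofReal_re, Complex.ofReal_im, zero_add]
      calc ‖g t‖ * Real.exp (A * poissonIntegral φ t η)
          ≤ ‖g t‖ * Real.exp (A * (φ t + ε)) := by gcongr; exact hη2 t
        _ = (‖g t‖ * Real.exp (A * φ t)) * Real.exp (A * ε) := by
            rw [mul_add, Real.exp_add]; ring
        _ ≤ 1 * Real.exp (A * ε) := by gcongr; exact hgφ t
        _ = _ := one_mul _
  have hcont : Tendsto (fun η : ℝ => poissonIntegral φ x (y + η)) (𝓝[>] 0)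
      (𝓝 (poissonIntegral φ x y)) := by
    have h3 : ContinuousAt (fun η : ℝ => (cauchyTransform φ (x + (y + η : ℝ) * Complex.I)).re) 0 := by
      refine Complex.continuous_re.continuousAt.comp ?_
      refine ContinuousAt.comp (g := cauchyTransform φ) ?_ (by fun_prop)
      refine (differentiableAt_cauchyTransform hφc hφs ?_).continuousAt
      simpa using hy
    have h4 : Tendsto _ (𝓝[>] (0 : ℝ)) _ := h3.tendsto.mono_left nhdsWithin_le_nhds
    rw [re_cauchyTransform hφc hφs (by simpa using hy)] at h4
    simp only [add_zero, Complex.add_re, Complex.ofReal_re, Complex.re_ofReal_mul, Complex.I_re,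
      mul_zero, Complex.add_im, Complex.ofReal_im, Complex.im_ofReal_mul, Complex.I_im, mul_one,
      zero_add] at h4
    refine h4.congr' ?_
    filter_upwards [self_mem_nhdsWithin] with η hη
    have hη : 0 < η := hη
    rw [re_cauchyTransform hφc hφs (by simp; linarith)]
    simp
  have hlim : ∀ ε : ℝ, 0 < ε →
      ‖g (x + y * Complex.I)‖ * Real.exp (A * poissonIntegral φ x y) ≤ Real.exp (A * ε) := by
    intro ε hε
    refine le_of_tendsto ?_ (hline ε hε)
    exact ((Real.continuous_exp.tendsto _).comp (hcont.const_mul A)).const_mul _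
  have hfin : ‖g (x + y * Complex.I)‖ * Real.exp (A * poissonIntegral φ x y) ≤ 1 := by
    have h5 : Tendsto (fun ε : ℝ => Real.exp (A * ε)) (𝓝[>] 0) (𝓝 1) := by
      have : Tendsto (fun ε : ℝ => Real.exp (A * ε)) (𝓝 0) (𝓝 (Real.exp (A * 0))) :=
        Continuous.tendsto (by fun_prop) _
      rw [mul_zero, Real.exp_zero] at this
      exact this.mono_left nhdsWithin_le_nhds
    refine ge_of_tendsto h5 ?_
    filter_upwards [self_mem_nhdsWithin] with ε hε using hlim ε hε
  have hlow : Real.pi⁻¹ * ∫ t in E, y / ((x - t) ^ 2 + y ^ 2) ≤ poissonIntegral φ x y := by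
    rw [poissonIntegral]
    refine mul_le_mul_of_nonneg_left ?_ (inv_nonneg.2 Real.pi_pos.le)
    have hk : Continuous fun t : ℝ => y / ((x - t) ^ 2 + y ^ 2) :=
      continuous_const.div (by fun_prop) fun t => by positivity
    have hφk : Integrable fun t => φ t * (y / ((x - t) ^ 2 + y ^ 2)) :=
      (hφc.mul hk).integrable_of_hasCompactSupport hφs.mul_right
    calc ∫ t in E, y / ((x - t) ^ 2 + y ^ 2)
        = ∫ t in E, φ t * (y / ((x - t) ^ 2 + y ^ 2)) :=
          setIntegral_congr_fun hE fun t ht => by simp [hφE t ht]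
      _ ≤ ∫ t, φ t * (y / ((x - t) ^ 2 + y ^ 2)) :=
          setIntegral_le_integral hφk (Eventually.of_forall fun t =>
            mul_nonneg (hφ0 t) (by positivity))
  calc ‖g (x + y * Complex.I)‖ ≤ (Real.exp (A * poissonIntegral φ x y))⁻¹ := by
        rw [← one_div, le_div_iff₀ (Real.exp_pos _)]; exact hfin
    _ = Real.exp (-(A * poissonIntegral φ x y)) := (Real.exp_neg _).symm
    _ ≤ _ := by gcongr

/-- The two constants theorem on a set of large measure near the point of evaluation. -/
theorem norm_le_exp_of_volume_ge {g : ℂ → ℂ} (hd : DiffContOnCl ℂ g {z | 0 < z.im})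
    (h1 : ∀ z : ℂ, 0 ≤ z.im → ‖g z‖ ≤ 1) {E : Set ℝ} (hE : MeasurableSet E) {x r : ℝ}
    (hr : 0 < r) (hEb : E ⊆ Icc (x - 2 * r) (x + 2 * r)) (hvol : r ≤ volume.real E) {A : ℝ}
    (hA : 0 ≤ A) (hgE : ∀ t ∈ E, ‖g t‖ ≤ Real.exp (-A)) {y : ℝ} (hy : r / 2 ≤ y) (hyr : y ≤ r) :
    ‖g (x + y * Complex.I)‖ ≤ Real.exp (-(A / 40)) := by
  have hy0 : 0 < y := by linarith
  refine (norm_le_exp_of_upper_half_plane hd h1 hE hEb hA hgE x hy0).trans ?_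
  have hfin : volume E ≠ ⊤ := ((measure_mono hEb).trans_lt (by simp)).ne
  have hk : Continuous fun t : ℝ => y / ((x - t) ^ 2 + y ^ 2) :=
    continuous_const.div (by fun_prop) fun t => by positivity
  -- On E the kernel is at least (r/2)/(4r² + r²) = 1/(10r). With π ≤ 4 this gives harmonic measure
  -- at least 1/40.
  have hint : (10 * r)⁻¹ * volume.real E ≤ ∫ t in E, y / ((x - t) ^ 2 + y ^ 2) := by
    have : ∫ t in E, (10 * r)⁻¹ = (10 * r)⁻¹ * volume.real E := by
      rw [setIntegral_const, smul_eq_mul, mul_comm]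
    rw [← this]
    refine setIntegral_mono_on (integrableOn_const hfin)
      ((hk.integrableOn_Icc (a := x - 2 * r) (b := x + 2 * r)).mono_set hEb) hE fun t ht => ?_
    have h2 := hEb ht
    have h3 : (x - t) ^ 2 ≤ 4 * r ^ 2 := by nlinarith [h2.1, h2.2]
    rw [← one_div, div_le_div_iff₀ (by positivity) (by positivity)]
    nlinarith
  have h4 : (1 / 10 : ℝ) ≤ ∫ t in E, y / ((x - t) ^ 2 + y ^ 2) := by
    refine le_trans ?_ hint
    rw [inv_mul_eq_div, div_le_div_iff₀ (by norm_num) (by positivity)]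
    linarith
  have h5 : (1 / 4 : ℝ) ≤ Real.pi⁻¹ := by
    rw [← one_div]; exact one_div_le_one_div_of_le Real.pi_pos Real.pi_le_four
  have h6 : (1 / 40 : ℝ) ≤ Real.pi⁻¹ * ∫ t in E, y / ((x - t) ^ 2 + y ^ 2) := by
    calc (1 / 40 : ℝ) = 1 / 4 * (1 / 10) := by norm_num
      _ ≤ _ := by gcongr
  gcongr
  calc A / 40 = A * (1 / 40) := by ring
    _ ≤ _ := by gcongr

/-! ### Truncated Fourier transforms in the upper half-plane. -/

/-- The holomorphic Fourier transform of `h dν` restricted to `(-∞, T)`. -/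
noncomputable def truncFourier (ν : Measure ℝ) (h : ℝ → ℂ) (T : ℝ) (z : ℂ) : ℂ :=
  ∫ t in Iio T, Complex.exp (-(Complex.I * t * z)) * h t ∂ν

/-- `truncFourier` translated so that the measure lives on a negative half-line; it is bounded in
the upper half-plane. -/
noncomputable def shiftFourier (ν : Measure ℝ) (h : ℝ → ℂ) (T : ℝ) (z : ℂ) : ℂ :=
  ∫ t in Iio T, Complex.exp (Complex.I * (T - t) * z) * h t ∂ν

theorem shiftFourier_eq (ν : Measure ℝ) (h : ℝ → ℂ) (T : ℝ) (z : ℂ) :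
    shiftFourier ν h T z = Complex.exp (Complex.I * T * z) * truncFourier ν h T z := by
  rw [shiftFourier, truncFourier, ← integral_const_mul]
  congr 1 with t
  rw [← mul_assoc, ← Complex.exp_add]
  ring_nf

theorem norm_truncFourier (ν : Measure ℝ) (h : ℝ → ℂ) (T : ℝ) (z : ℂ) :
    ‖truncFourier ν h T z‖ = Real.exp (T * z.im) * ‖shiftFourier ν h T z‖ := by
  rw [shiftFourier_eq, norm_mul, Complex.norm_exp, ← mul_assoc, ← Real.exp_add]
  simp

theorem norm_exp_neg_I_mul (t : ℝ) (z : ℂ) :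
    ‖Complex.exp (-(Complex.I * t * z))‖ = Real.exp (t * z.im) := by
  rw [Complex.norm_exp]; simp

theorem norm_exp_I_sub_mul (T t : ℝ) (z : ℂ) :
    ‖Complex.exp (Complex.I * (T - t) * z)‖ = Real.exp (-((T - t) * z.im)) := by
  rw [Complex.norm_exp]; simp

section

variable {ν : Measure ℝ} [IsFiniteMeasure ν] {h : ℝ → ℂ}

theorem norm_exp_I_sub_mul_mul_le (hb : ∀ t, ‖h t‖ ≤ 1) {T t : ℝ} (ht : t < T) {z : ℂ}
    (hz : 0 ≤ z.im) : ‖Complex.exp (Complex.I * (T - t) * z) * h t‖ ≤ 1 := by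
  rw [norm_mul, norm_exp_I_sub_mul]
  refine mul_le_one₀ ?_ (norm_nonneg _) (hb t)
  rw [Real.exp_le_one_iff, neg_nonpos]
  exact mul_nonneg (sub_pos.2 ht).le hz

theorem norm_shiftFourier_le (hb : ∀ t, ‖h t‖ ≤ 1) (T : ℝ) {z : ℂ} (hz : 0 ≤ z.im) :
    ‖shiftFourier ν h T z‖ ≤ ν.real univ := by
  have := norm_setIntegral_le_of_norm_le_const (μ := ν) (s := Iio T) (C := 1)
    (f := fun t : ℝ => Complex.exp (Complex.I * (T - t) * z) * h t) (measure_lt_top _ _)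
    fun t ht => norm_exp_I_sub_mul_mul_le hb ht hz
  refine this.trans ?_
  rw [one_mul]
  exact measureReal_mono (subset_univ _)

theorem diffContOnCl_const_mul (c : ℂ) {f : ℂ → ℂ} {s : Set ℂ} (hf : DiffContOnCl ℂ f s) :
    DiffContOnCl ℂ (fun z => c * f z) s := hf.const_smul c

theorem mul_exp_neg_le (u : ℝ) {c : ℝ} (hc : 0 < c) : u * Real.exp (-(u * c)) ≤ c⁻¹ := by
  have h1 : u * c ≤ Real.exp (u * c) := by linarith [Real.add_one_le_exp (u * c)]
  rw [Real.exp_neg, ← div_eq_mul_inv, div_le_iff₀ (Real.exp_pos _), inv_mul_eq_div, le_div_iff₀ hc]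
  exact h1

theorem differentiableAt_shiftFourier (hm : Measurable h) (hb : ∀ t, ‖h t‖ ≤ 1) (T : ℝ) {z : ℂ}
    (hz : 0 < z.im) : DifferentiableAt ℂ (shiftFourier ν h T) z := by
  have hball : ∀ w ∈ Metric.ball z (z.im / 2), z.im / 2 < w.im := by
    intro w hw
    have h1 : |(w - z).im| ≤ ‖w - z‖ := Complex.abs_im_le_norm _
    rw [Metric.mem_ball, dist_eq_norm] at hw
    have h2 := (abs_lt.1 (h1.trans_lt hw)).1
    simp at h2
    linarith
  have h2 : 0 < z.im / 2 := by positivity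
  have hmeas : ∀ w : ℂ, AEStronglyMeasurable
      (fun t : ℝ => Complex.exp (Complex.I * (T - t) * w) * h t) (ν.restrict (Iio T)) := fun w =>
    Measurable.aestronglyMeasurable (by fun_prop)
  have key := hasDerivAt_integral_of_dominated_loc_of_deriv_le (μ := ν.restrict (Iio T))
    (F := fun (w : ℂ) (t : ℝ) => Complex.exp (Complex.I * (T - t) * w) * h t)
    (F' := fun (w : ℂ) (t : ℝ) =>
      Complex.exp (Complex.I * (T - t) * w) * (Complex.I * (T - t)) * h t)
    (x₀ := z) (s := Metric.ball z (z.im / 2)) (bound := fun _ => (z.im / 2)⁻¹)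
    (Metric.ball_mem_nhds _ h2) (Eventually.of_forall hmeas) ?_
    (Measurable.aestronglyMeasurable (by fun_prop)) ?_ (integrable_const _) ?_
  · exact key.2.differentiableAt
  · refine Integrable.of_bound (hmeas z) 1 ?_
    filter_upwards [ae_restrict_mem measurableSet_Iio] with t ht
    exact norm_exp_I_sub_mul_mul_le hb ht hz.le
  · filter_upwards [ae_restrict_mem measurableSet_Iio] with t ht w hw
    have hT : 0 < T - t := sub_pos.2 ht
    rw [norm_mul, norm_mul, norm_exp_I_sub_mul, norm_mul, Complex.norm_I, one_mul,
      ← Complex.ofReal_sub, Complex.norm_real, Real.norm_eq_abs, abs_of_pos hT, mul_comm (Real.exp _)]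
    calc (T - t) * Real.exp (-((T - t) * w.im)) * ‖h t‖
        ≤ (T - t) * Real.exp (-((T - t) * (z.im / 2))) * 1 := by
          gcongr
          · exact (hball w hw).le
          · exact hb t
      _ ≤ (z.im / 2)⁻¹ := by rw [mul_one]; exact mul_exp_neg_le _ h2
  · refine Eventually.of_forall fun t w hw => ?_
    have h3 := ((hasDerivAt_id w).const_mul (Complex.I * ((T : ℂ) - t))).cexp.mul_const (h t)
    simpa using h3

theorem diffContOnCl_shiftFourier (hm : Measurable h) (hb : ∀ t, ‖h t‖ ≤ 1) (T : ℝ) :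
    DiffContOnCl ℂ (shiftFourier ν h T) {z | 0 < z.im} := by
  refine ⟨fun z hz => (differentiableAt_shiftFourier hm hb T hz).differentiableWithinAt, ?_⟩
  rw [Complex.closure_setOfPred_lt_im]
  refine continuousOn_of_dominated (bound := fun _ => (1 : ℝ)) (fun z _ => ?_) (fun z hz => ?_)
    (integrable_const _) ?_
  · exact Measurable.aestronglyMeasurable (by fun_prop)
  · filter_upwards [ae_restrict_mem measurableSet_Iio] with t ht
    exact norm_exp_I_sub_mul_mul_le hb ht hz
  · exact Eventually.of_forall fun t => Continuous.continuousOn (by fun_prop)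

theorem norm_truncFourier_sub_le (hm : Measurable h) (hb : ∀ t, ‖h t‖ ≤ 1) {T T' : ℝ}
    (hT : T ≤ T') {z : ℂ} (hz : 0 ≤ z.im) :
    ‖truncFourier ν h T' z - truncFourier ν h T z‖ ≤ Real.exp (T' * z.im) * ν.real (Ici T) := by
  have hbd : ∀ t ∈ Iio T', ‖Complex.exp (-(Complex.I * t * z)) * h t‖ ≤ Real.exp (T' * z.im) := by
    intro t ht
    rw [norm_mul, norm_exp_neg_I_mul]
    calc Real.exp (t * z.im) * ‖h t‖ ≤ Real.exp (T' * z.im) * 1 := by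
          gcongr
          · exact (mem_Iio.1 ht).le
          · exact hb t
      _ = _ := mul_one _
  have hint : IntegrableOn (fun t : ℝ => Complex.exp (-(Complex.I * t * z)) * h t) (Iio T') ν := by
    refine Integrable.of_bound (Measurable.aestronglyMeasurable (by fun_prop))
      (Real.exp (T' * z.im)) ?_
    filter_upwards [ae_restrict_mem measurableSet_Iio] with t ht using hbd t ht
  rw [truncFourier, truncFourier, ← setIntegral_sdiff measurableSet_Iio hint (Iio_subset_Iio hT)]
  refine (norm_setIntegral_le_of_norm_le_const (measure_lt_top _ _)
    fun t ht => hbd t ht.1).trans ?_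
  gcongr
  · finiteness
  · intro t ht
    exact mem_Ici.2 (not_lt.1 fun hlt => ht.2 (mem_Iio.2 hlt))

theorem norm_truncFourier_le_of_integral_eq_zero (hm : Measurable h) (hb : ∀ t, ‖h t‖ ≤ 1) (T : ℝ)
    {ξ : ℝ} (h0 : ∫ t : ℝ, Complex.exp (-(Complex.I * t * ξ)) * h t ∂ν = 0) :
    ‖truncFourier ν h T ξ‖ ≤ ν.real (Ici T) := by
  have hbd : ∀ t : ℝ, ‖Complex.exp (-(Complex.I * t * ξ)) * h t‖ ≤ 1 := by
    intro t
    rw [norm_mul, norm_exp_neg_I_mul]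
    simpa using hb t
  have hint : Integrable (fun t : ℝ => Complex.exp (-(Complex.I * t * ξ)) * h t) ν :=
    Integrable.of_bound (Measurable.aestronglyMeasurable (by fun_prop)) 1 (Eventually.of_forall hbd)
  have := integral_add_compl (measurableSet_Iio (a := T)) hint
  rw [h0, compl_Iio] at this
  rw [truncFourier, eq_neg_of_add_eq_zero_left this, norm_neg]
  simpa using norm_setIntegral_le_of_norm_le_const (measure_lt_top ν (Ici T))
    fun t _ => hbd t

end

/-! ### Propagation of smallness from one scale to the next. -/

/-- Exponential smallness of `truncFourier` near the segment of radius `a` centred at `x₀`. -/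
def SmallNear (ν : Measure ℝ) (h : ℝ → ℂ) (M T l x₀ a : ℝ) : Prop :=
  ∀ x y : ℝ, |x - x₀| ≤ a → 0 < y → y ≤ l / (960 * T) →
    ‖truncFourier ν h T (x + y * Complex.I)‖ ≤ M * Real.exp (4 / l - T * y)

theorem SmallNear.mono {ν : Measure ℝ} {h : ℝ → ℂ} {M T l x₀ a b : ℝ}
    (H : SmallNear ν h M T l x₀ b) (hab : a ≤ b) : SmallNear ν h M T l x₀ a :=
  fun x y hx => H x y (hx.trans hab)

section

variable {ν : Measure ℝ} [IsFiniteMeasure ν] {h : ℝ → ℂ}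

/-- Passage from smallness on a horizontal segment to smallness in a rectangle below it. -/
theorem norm_truncFourier_le_of_segment (hm : Measurable h) (hb : ∀ t, ‖h t‖ ≤ 1) {K T H A : ℝ}
    (hK : 0 < K) (hνK : ν.real univ ≤ K) (hH : 0 < H) (hA : 0 ≤ A) (hAT : 6 * T * H ≤ A) {t₀ : ℝ}
    (hseg : ∀ x : ℝ, |x - t₀| ≤ H → ‖shiftFourier ν h T (x + H * Complex.I)‖ ≤ K * Real.exp (-A))
    {x y : ℝ} (hx : |x - t₀| ≤ H / 2) (hy : 0 ≤ y) (hyH : y ≤ H) :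
    ‖truncFourier ν h T (x + y * Complex.I)‖ ≤ K * Real.exp (-(T * y)) := by
  have hKc : ‖(K : ℂ)⁻¹‖ = K⁻¹ := by
    rw [norm_inv, Complex.norm_real, Real.norm_eq_abs, abs_of_pos hK]
  have h3 := norm_le_exp_of_strip (g := fun z => (K : ℂ)⁻¹ * shiftFourier ν h T z) (t₀ := t₀) hH hA
    (diffContOnCl_const_mul _ (diffContOnCl_shiftFourier hm hb T)) (fun z hz => ?_)
    (fun x hx => ?_) hx hy hyH
  · rw [norm_mul, hKc, inv_mul_le_iff₀ hK] at h3
    rw [norm_truncFourier]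
    have e : ((x : ℂ) + y * Complex.I).im = y := by simp
    rw [e]
    -- The condition 6TH ≤ A makes the decay e^{-2Ty}: one factor e^{-Ty} undoes the shift, the
    -- other remains as gain.
    have h4 : 2 * (T * y) ≤ A * y / (3 * H) := by
      rw [le_div_iff₀ (by positivity)]
      nlinarith
    calc Real.exp (T * y) * ‖shiftFourier ν h T (x + y * Complex.I)‖
        ≤ Real.exp (T * y) * (K * Real.exp (-(2 * (T * y)))) := by
          gcongr
          refine h3.trans ?_
          gcongr
      _ = K * Real.exp (-(T * y)) := by
          rw [mul_left_comm, ← Real.exp_add]; ring_nf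
  · rw [norm_mul, hKc, inv_mul_le_iff₀ hK, mul_one]
    exact (norm_shiftFourier_le hb T hz).trans hνK
  · rw [norm_mul, hKc, inv_mul_le_iff₀ hK]
    exact hseg x hx

/-- Starting point of the propagation. With r = l/(240T), the two constants theorem gives the factor
e^{-l/40} on the segment of height r above |x - x₀| ≤ r, and l/40 = 6Tr is exactly what the passage
to the rectangle below requires. -/
theorem smallNear_of_volume_ge (hm : Measurable h) (hb : ∀ t, ‖h t‖ ≤ 1) {M T l x₀ : ℝ}
    (hM : 0 < M) (hνM : ν.real univ ≤ M) (hT : 0 < T) (hl : 0 < l) {E : Set ℝ}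
    (hE : MeasurableSet E)
    (hFE : ∀ ξ ∈ E, ‖truncFourier ν h T ξ‖ ≤ M * Real.exp (-l))
    (hvol : l / (240 * T) ≤
      volume.real (E ∩ Icc (x₀ - l / (240 * T)) (x₀ + l / (240 * T)))) :
    SmallNear ν h M T l x₀ (2 * (l / (960 * T))) := by
  intro x y hx hy hyl
  set r := l / (240 * T) with hr
  have hr0 : 0 < r := by positivity
  have hr4 : l / (960 * T) = r / 4 := by rw [hr]; field_simp; norm_num
  rw [hr4] at hx hyl
  have hMc : ‖(M : ℂ)⁻¹‖ = M⁻¹ := by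
    rw [norm_inv, Complex.norm_real, Real.norm_eq_abs, abs_of_pos hM]
  have key := norm_truncFourier_le_of_segment (A := l / 40) (T := T) (t₀ := x₀) hm hb hM hνM hr0
    (by positivity) ?_ ?_ (x := x) (y := y) (by linarith) hy.le (by linarith)
  · refine key.trans ?_
    gcongr
    have : 0 < 4 / l := by positivity
    linarith
  · rw [hr]; field_simp; norm_num
  · intro x hx
    have h3 := norm_le_exp_of_volume_ge (g := fun z => (M : ℂ)⁻¹ * shiftFourier ν h T z) (x := x)
      (y := r) (A := l)
      (diffContOnCl_const_mul _ (diffContOnCl_shiftFourier hm hb T)) ?_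
      (hE.inter measurableSet_Icc) hr0 ?_ hvol hl.le ?_ (by linarith) le_rfl
    · rwa [norm_mul, hMc, inv_mul_le_iff₀ hM] at h3
    · intro z hz
      rw [norm_mul, hMc, inv_mul_le_iff₀ hM, mul_one]
      exact (norm_shiftFourier_le hb T hz).trans hνM
    · intro t ht
      have h4 := abs_le.1 hx
      exact ⟨by linarith [ht.2.1, h4.2], by linarith [ht.2.2, h4.1]⟩
    · intro t ht
      rw [norm_mul, hMc, inv_mul_le_iff₀ hM]
      have h4 := hFE t ht.1
      rw [norm_truncFourier] at h4
      simpa using h4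

/-- The smallness of the transform truncated at T' passes to the one truncated at T on a low
horizontal segment. Harmonic measure carries it to height Y = l/(960T), over points up to Y/2 beyond
the old interval and their neighbourhoods of radius Y; the rectangle estimate brings it back down.
The exponent is again exact: l/160 = 6TY. -/
theorem SmallNear.step (hm : Measurable h) (hb : ∀ t, ‖h t‖ ≤ 1) {M T T' l l' x₀ a : ℝ}
    (hM : 0 < M) (hνM : ν.real univ ≤ M) (hT : 0 < T) (hl : 0 < l) (hT' : 480 * T ≤ T')
    (hl' : 240 * l ≤ l') (hV : ν.real (Ici T) ≤ M * Real.exp (-l))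
    (hS : SmallNear ν h M T' l' x₀ a) (ha : l / (960 * T) / 2 ≤ a) :
    SmallNear ν h M T l x₀ (a + l / (960 * T) / 2) := by
  intro x y hx hy hyl
  set Y := l / (960 * T) with hY
  have hY0 : 0 < Y := by positivity
  have hT'0 : 0 < T' := by linarith
  have hl'0 : 0 < l' := by linarith
  -- At this height e^{T'h₀} = e^{l/4}: the gain of the T'-transform is e^{-l/4}, and the truncation
  -- error is e^{l/4} · e^{-l}. The ratios 480 and 240 are what h₀ ≤ Y/2 and h₀ ≤ l'/(960T')
  -- require.
  set h₀ := l / (4 * T') with hh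
  have hh0 : 0 < h₀ := by positivity
  have hTh : T' * h₀ = l / 4 := by rw [hh]; field_simp
  have hhY : h₀ ≤ Y / 2 := by
    rw [hh, hY, div_div, div_le_div_iff₀ (by positivity) (by positivity)]
    nlinarith
  have hhl : h₀ ≤ l' / (960 * T') := by
    rw [hh, div_le_div_iff₀ (by positivity) (by positivity)]
    nlinarith
  set K := M * Real.exp (4 / l) with hK
  have hK0 : 0 < K := by positivity
  have hMK : M ≤ K := le_mul_of_one_le_right hM.le (Real.one_le_exp (by positivity))
  have hKc : ‖(K : ℂ)⁻¹‖ = K⁻¹ := by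
    rw [norm_inv, Complex.norm_real, Real.norm_eq_abs, abs_of_pos hK0]
  -- The factor exp(4/l) in `SmallNear` exists for this inequality: it absorbs the truncation error,
  -- so constants do not accumulate over arbitrarily many steps.
  have hexp : Real.exp (4 / l') + Real.exp (-(l / 2)) ≤ Real.exp (4 / l) := by
    have h1 : Real.exp (-(l / 2)) ≤ 2 / l := by
      have := Real.add_one_le_exp (l / 2)
      rw [Real.exp_neg, inv_le_comm₀ (Real.exp_pos _) (by positivity), inv_div]
      linarith
    have h2 : 4 / l' ≤ 1 / l := by
      rw [div_le_div_iff₀ hl'0 hl]; linarith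
    have h3 : Real.exp (4 / l) = Real.exp (1 / l) * Real.exp (3 / l) := by
      rw [← Real.exp_add]; ring_nf
    have h4 := Real.add_one_le_exp (3 / l)
    have h5 : 1 ≤ Real.exp (1 / l) := Real.one_le_exp (by positivity)
    have h6 : Real.exp (4 / l') ≤ Real.exp (1 / l) := by gcongr
    have h7 : 2 / l ≤ 3 / l := by gcongr; norm_num
    have h8 : 0 < 3 / l := by positivity
    rw [h3]
    nlinarith
  have hbase : ∀ t : ℝ, |t - x₀| ≤ a →
      ‖shiftFourier ν h T (t + h₀ * Complex.I)‖ ≤ K * Real.exp (-(l / 4)) := by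
    intro t ht
    have e : ((t : ℂ) + h₀ * Complex.I).im = h₀ := by simp
    have h1 := hS t h₀ ht hh0 hhl
    have h2 := norm_truncFourier_sub_le (ν := ν) hm hb (T := T) (T' := T') (by linarith)
      (z := t + h₀ * Complex.I) (by rw [e]; exact hh0.le)
    rw [e, hTh] at h2
    rw [hTh] at h1
    have h3 : ‖shiftFourier ν h T (t + h₀ * Complex.I)‖ ≤
        ‖truncFourier ν h T (t + h₀ * Complex.I)‖ := by
      rw [norm_truncFourier, e]
      exact le_mul_of_one_le_left (norm_nonneg _) (Real.one_le_exp (by positivity))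
    have h4 := norm_sub_norm_le (truncFourier ν h T (t + h₀ * Complex.I))
      (truncFourier ν h T' (t + h₀ * Complex.I))
    rw [norm_sub_rev] at h4
    have h5 : Real.exp (l / 4) * ν.real (Ici T) ≤ M * (Real.exp (-(l / 2)) * Real.exp (-(l / 4))) := by
      calc _ ≤ Real.exp (l / 4) * (M * Real.exp (-l)) := by gcongr
        _ = _ := by rw [mul_left_comm, ← Real.exp_add, ← Real.exp_add]; ring_nf
    have h6 : M * Real.exp (4 / l' - l / 4) = M * (Real.exp (4 / l') * Real.exp (-(l / 4))) := by
      rw [← Real.exp_add]; ring_nf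
    calc ‖shiftFourier ν h T (t + h₀ * Complex.I)‖
        ≤ M * (Real.exp (4 / l') * Real.exp (-(l / 4))) +
          M * (Real.exp (-(l / 2)) * Real.exp (-(l / 4))) := by linarith
      _ = M * (Real.exp (4 / l') + Real.exp (-(l / 2))) * Real.exp (-(l / 4)) := by ring
      _ ≤ K * Real.exp (-(l / 4)) := by rw [hK]; gcongr
  -- The witness is the projection of x onto the interval of radius a about x₀.
  obtain ⟨t₀, ht₀, hxt₀⟩ : ∃ t₀, |t₀ - x₀| ≤ a ∧ |x - t₀| ≤ Y / 2 := by
    have ha0 : 0 < a := by linarith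
    have h1 := abs_le.1 hx
    refine ⟨max (x₀ - a) (min x (x₀ + a)), abs_le.2 ⟨?_, ?_⟩, abs_le.2 ⟨?_, ?_⟩⟩
    · linarith [le_max_left (x₀ - a) (min x (x₀ + a))]
    · have : max (x₀ - a) (min x (x₀ + a)) ≤ x₀ + a := max_le (by linarith) (min_le_right _ _)
      linarith
    · have : max (x₀ - a) (min x (x₀ + a)) ≤ x + Y / 2 :=
        max_le (by linarith [h1.1]) ((min_le_left _ _).trans (by linarith))
      linarith
    · have : x - Y / 2 ≤ min x (x₀ + a) := le_min (by linarith) (by linarith [h1.2])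
      linarith [le_max_right (x₀ - a) (min x (x₀ + a))]
  have hz : ∀ y : ℝ, (Complex.I : ℂ) * y = y * Complex.I := fun y => mul_comm _ _
  have key := norm_truncFourier_le_of_segment (A := l / 160) (T := T) (t₀ := t₀) hm hb hK0
    (hνM.trans hMK) hY0 (by positivity) ?_ ?_ hxt₀ hy.le hyl
  · refine key.trans (le_of_eq ?_)
    rw [hK, mul_assoc, ← Real.exp_add]; ring_nf
  · rw [hY]; field_simp; norm_num
  · intro s hs
    have hs' := abs_le.1 hs
    have ht₀' := abs_le.1 ht₀
    -- The window [p, p + Y] contains t₀ and stays in the old interval, which is where Y/2 ≤ a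
    -- enters. It lies within 2Y of every s with |s - t₀| ≤ Y.
    set p := max (x₀ - a) (t₀ - Y) with hp
    have hp1 : x₀ - a ≤ p := le_max_left _ _
    have hp2 : t₀ - Y ≤ p := le_max_right _ _
    have hp3 : p + Y ≤ x₀ + a := by
      have : p ≤ x₀ + a - Y := max_le (by linarith) (by linarith [ht₀'.2])
      linarith
    have hp4 : p ≤ t₀ := max_le (by linarith [ht₀'.1]) (by linarith)
    have hmap : MapsTo (fun z : ℂ => z + h₀ * Complex.I) {z | 0 < z.im} {z | 0 < z.im} := by
      intro z hz
      have hz : 0 < z.im := hz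
      change 0 < (z + h₀ * Complex.I).im
      simp; linarith
    have hd : DiffContOnCl ℂ (fun z => (K : ℂ)⁻¹ * shiftFourier ν h T (z + h₀ * Complex.I))
        {z | 0 < z.im} := by
      have hd1 : DiffContOnCl ℂ (fun z : ℂ => z + h₀ * Complex.I) {z | 0 < z.im} :=
        Differentiable.diffContOnCl (by fun_prop)
      exact diffContOnCl_const_mul _ ((diffContOnCl_shiftFourier (ν := ν) hm hb T).comp hd1 hmap)
    have h3 := norm_le_exp_of_volume_ge (x := s) (y := Y - h₀) (A := l / 4) (E := Icc p (p + Y))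
      hd ?_ measurableSet_Icc hY0 ?_ ?_ (by positivity) ?_ (by linarith) (by linarith)
    · rw [norm_mul, hKc, inv_mul_le_iff₀ hK0] at h3
      have e : (s : ℂ) + ((Y - h₀ : ℝ) : ℂ) * Complex.I + h₀ * Complex.I = s + Y * Complex.I := by
        push_cast; ring
      rw [e] at h3
      refine h3.trans (le_of_eq ?_)
      ring_nf
    · intro z hz
      rw [norm_mul, hKc, inv_mul_le_iff₀ hK0, mul_one]
      refine (norm_shiftFourier_le hb T ?_).trans (hνM.trans hMK)
      simp; linarith
    · exact Icc_subset_Icc (by linarith [hs'.1, hs'.2]) (by linarith [hs'.1, hs'.2])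
    · simp [Measure.real, hY0.le]
    · intro t ht
      rw [norm_mul, hKc, inv_mul_le_iff₀ hK0]
      exact hbase t (abs_le.2 ⟨by linarith [ht.1], by linarith [ht.2]⟩)

/-- If the density condition holds at all scales occurring, the Fourier transform vanishes. -/
theorem integral_eq_zero_of_sequences (hm : Measurable h) (hb : ∀ t, ‖h t‖ ≤ 1) {M x₀ : ℝ}
    (hM : 0 < M) (hνM : ν.real univ ≤ M) {T l : ℕ → ℝ} (hT0 : ∀ n, 0 < T n) (hl0 : ∀ n, 0 < l n)
    (hT : ∀ n, 480 * T n ≤ T (n + 1)) (hl : ∀ n, 240 * l n ≤ l (n + 1))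
    (hdiv : ¬Summable fun n => l n / T n)
    (hV : ∀ n, ν.real (Ici (T n)) ≤ M * Real.exp (-l n)) {E : Set ℝ} (hE : MeasurableSet E)
    (hFE : ∀ ξ ∈ E, ∫ t : ℝ, Complex.exp (-(Complex.I * t * ξ)) * h t ∂ν = 0)
    (hvol : ∀ n, l n / (240 * T n) ≤
      volume.real (E ∩ Icc (x₀ - l n / (240 * T n)) (x₀ + l n / (240 * T n)))) (ξ : ℝ) :
    ∫ t : ℝ, Complex.exp (-(Complex.I * t * ξ)) * h t ∂ν = 0 := by
  have hbase : ∀ n, SmallNear ν h M (T n) (l n) x₀ (2 * (l n / (960 * T n))) := fun n =>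
    smallNear_of_volume_ge hm hb hM hνM (hT0 n) (hl0 n) hE (fun ξ hξ =>
      (norm_truncFourier_le_of_integral_eq_zero hm hb _ (hFE ξ hξ)).trans (hV n)) (hvol n)
  have hY0 : ∀ n, 0 < l n / (960 * T n) := fun n => by have := hT0 n; have := hl0 n; positivity
  -- The induction is on the number d of steps with n free: the smallness at n comes from that at n
  -- + 1.
  have hsum : ∀ d n, SmallNear ν h M (T n) (l n) x₀
      (∑ i ∈ Finset.range d, l (n + i) / (960 * T (n + i)) / 2) := by
    intro d
    induction d with
    | zero => intro n; exact (hbase n).mono (by simpa using (hY0 n).le)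
    | succ d ih =>
      intro n
      have e : ∑ i ∈ Finset.range (d + 1), l (n + i) / (960 * T (n + i)) / 2 =
          (∑ i ∈ Finset.range d, l (n + 1 + i) / (960 * T (n + 1 + i)) / 2) +
            l n / (960 * T n) / 2 := by
        rw [Finset.sum_range_succ', add_zero]
        congr 1
        refine Finset.sum_congr rfl fun i _ => ?_
        rw [show n + (i + 1) = n + 1 + i by ring]
      rw [e]
      -- If the accumulated radius is below Y/2, the step does not apply, but the initial radius 2Y
      -- already exceeds the new one.
      by_cases ha : l n / (960 * T n) / 2 ≤
          ∑ i ∈ Finset.range d, l (n + 1 + i) / (960 * T (n + 1 + i)) / 2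
      · exact SmallNear.step hm hb hM hνM (hT0 n) (hl0 n) (hT n) (hl n) (hV n) (ih (n + 1)) ha
      · exact (hbase n).mono (by linarith [hY0 n])
  have hall : ∀ n a, SmallNear ν h M (T n) (l n) x₀ a := by
    intro n a
    have hd : ¬Summable fun i => l (n + i) / (960 * T (n + i)) / 2 := by
      intro hs
      apply hdiv
      have h1 : Summable fun i => l (i + n) / T (i + n) := by
        refine (hs.mul_left 1920).congr fun i => ?_
        rw [add_comm n i]
        have := (hT0 (i + n)).ne'
        field_simp
        ring
      exact (summable_nat_add_iff (f := fun n => l n / T n) n).1 h1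
    have ht := (not_summable_iff_tendsto_nat_atTop_of_nonneg
      (fun i => (half_pos (hY0 (n + i))).le)).1 hd
    obtain ⟨d, hd⟩ := (ht.eventually_ge_atTop a).exists
    exact (hsum d n).mono hd
  have hlt : Tendsto l atTop atTop := by
    have h1 : ∀ n, l 0 * 2 ^ n ≤ l n := by
      intro n
      induction n with
      | zero => simp
      | succ n ih => rw [pow_succ]; linarith [hl n, hl0 n]
    refine tendsto_atTop_mono h1 ?_
    exact (tendsto_pow_atTop_atTop_of_one_lt one_lt_two).const_mul_atTop (hl0 0)
  have hTt : Tendsto T atTop atTop := by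
    have h1 : ∀ n, T 0 * 2 ^ n ≤ T n := by
      intro n
      induction n with
      | zero => simp
      | succ n ih => rw [pow_succ]; linarith [hT n, hT0 n]
    refine tendsto_atTop_mono h1 ?_
    exact (tendsto_pow_atTop_atTop_of_one_lt one_lt_two).const_mul_atTop (hT0 0)
  have hlmono : ∀ n, l 0 ≤ l n := by
    intro n
    induction n with
    | zero => exact le_rfl
    | succ n ih => linarith [hl n, hl0 n]
  -- At height m/T_n the truncated integrand is dominated by e^m, while the smallness gives a gain
  -- of e^{-m}. The height is admissible once l_n ≥ 960m.
  have hfin : ∀ m : ℝ, 0 < m → ‖∫ t : ℝ, Complex.exp (-(Complex.I * t * ξ)) * h t ∂ν‖ ≤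
      M * Real.exp (4 / l 0) * Real.exp (-m) := by
    intro m hm0
    have hlim : Tendsto (fun n => truncFourier ν h (T n) (ξ + (m / T n : ℝ) * Complex.I)) atTop
        (𝓝 (∫ t : ℝ, Complex.exp (-(Complex.I * t * ξ)) * h t ∂ν)) := by
      simp only [truncFourier]
      simp_rw [← integral_indicator measurableSet_Iio]
      refine tendsto_integral_of_dominated_convergence (fun _ => Real.exp m) (fun n => ?_)
        (integrable_const _) (fun n => Eventually.of_forall fun t => ?_)
        (Eventually.of_forall fun t => ?_)
      · exact (Measurable.indicator (by fun_prop) measurableSet_Iio).aestronglyMeasurable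
      · by_cases ht : t ∈ Iio (T n)
        · rw [indicator_of_mem ht, norm_mul, norm_exp_neg_I_mul]
          have e : ((ξ : ℂ) + (m / T n : ℝ) * Complex.I).im = m / T n := by simp
          rw [e]
          have h1 : t * (m / T n) ≤ m := by
            rw [mul_div_assoc', div_le_iff₀ (hT0 n), mul_comm]
            gcongr
            exact (mem_Iio.1 ht).le
          calc Real.exp (t * (m / T n)) * ‖h t‖ ≤ Real.exp m * 1 := by
                gcongr; exact hb t
            _ = _ := mul_one _
        · rw [indicator_of_notMem ht, norm_zero]; exact (Real.exp_pos _).le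
      · have h1 : Tendsto (fun n => (m / T n : ℝ)) atTop (𝓝 0) := hTt.const_div_atTop m
        have h2 : Tendsto (fun n => Complex.exp (-(Complex.I * t * (ξ + (m / T n : ℝ) * Complex.I)))
            * h t) atTop (𝓝 (Complex.exp (-(Complex.I * t * (ξ + (0 : ℝ) * Complex.I))) * h t)) := by
          have hc : Continuous fun r : ℝ =>
            Complex.exp (-(Complex.I * t * (ξ + (r : ℝ) * Complex.I))) * h t := by fun_prop
          exact (hc.tendsto 0).comp h1
        simp only [Complex.ofReal_zero, zero_mul, add_zero] at h2
        refine h2.congr' ?_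
        filter_upwards [hTt.eventually_gt_atTop t] with n hn
        rw [indicator_of_mem (mem_Iio.2 hn)]
    refine le_of_tendsto hlim.norm ?_
    filter_upwards [hlt.eventually_ge_atTop (960 * m)] with n hn
    have hTn := hT0 n
    refine (hall n |ξ - x₀| ξ (m / T n) le_rfl (by positivity) ?_).trans ?_
    · rw [div_le_div_iff₀ hTn (by positivity)]
      nlinarith
    · rw [mul_div_cancel₀ _ hTn.ne', sub_eq_add_neg, Real.exp_add, ← mul_assoc]
      have h1 : 4 / l n ≤ 4 / l 0 := by
        have := hl0 0
        gcongr
        exact hlmono n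
      gcongr
  have hlim0 : Tendsto (fun m : ℝ => M * Real.exp (4 / l 0) * Real.exp (-m)) atTop (𝓝 0) := by
    have := (Real.tendsto_exp_neg_atTop_nhds_zero).const_mul (M * Real.exp (4 / l 0))
    simpa using this
  have hle : ‖∫ t : ℝ, Complex.exp (-(Complex.I * t * ξ)) * h t ∂ν‖ ≤ 0 := by
    refine ge_of_tendsto hlim0 ?_
    filter_upwards [eventually_gt_atTop 0] with m hm0 using hfin m hm0
  exact norm_le_zero_iff.1 hle

end

/-! ### Choice of the base point and of the scales. -/

theorem exists_density_point {E : Set ℝ} (hpos : 0 < volume E) :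
    ∃ x₀ ρ : ℝ, 0 < ρ ∧ ∀ r, 0 < r → r ≤ ρ → r ≤ volume.real (E ∩ Icc (x₀ - r) (x₀ + r)) := by
  have hne : volume.restrict E ≠ 0 := by
    rw [Ne, Measure.restrict_eq_zero]; exact hpos.ne'
  have : (ae (volume.restrict E)).NeBot := ae_neBot.2 hne
  obtain ⟨x, hx⟩ := (Besicovitch.ae_tendsto_measure_inter_div volume E).exists
  have h2 := hx.eventually (lt_mem_nhds (show (2⁻¹ : ENNReal) < 1 by simp))
  obtain ⟨ρ, hρ, hsub⟩ := mem_nhdsGT_iff_exists_Ioc_subset.1 h2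
  refine ⟨x, ρ, hρ, fun r hr hrρ => ?_⟩
  have h3 : (2⁻¹ : ENNReal) <
    volume (E ∩ Metric.closedBall x r) / volume (Metric.closedBall x r) := hsub ⟨hr, hrρ⟩
  rw [Real.volume_closedBall, Real.closedBall_eq_Icc] at h3
  have h4 : 2⁻¹ * ENNReal.ofReal (2 * r) ≤ volume (E ∩ Icc (x - r) (x + r)) :=
    ENNReal.mul_le_of_le_div h3.le
  have h5 : volume (E ∩ Icc (x - r) (x + r)) ≠ ⊤ :=
    ((measure_mono inter_subset_right).trans_lt (by simp)).ne
  have h6 := ENNReal.toReal_mono h5 h4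
  rw [ENNReal.toReal_mul, ENNReal.toReal_ofReal (by positivity)] at h6
  simpa [Measure.real] using h6

/-- Greedy choice: the next index is the first at which w has grown by the factor 240. Before it w
stays below 240 w(k n), so the geometric weights bound the whole block by a multiple of its first
term, and divergence survives. -/
theorem exists_sparse_subsequence {w : ℕ → ℝ} (hw : Monotone w) (hw0 : ∀ k, 0 ≤ w k)
    (hdiv : ¬Summable fun k => w k / 480 ^ k) :
    ∃ k : ℕ → ℕ, StrictMono k ∧ (∀ n, 0 < w (k n)) ∧ (∀ n, 240 * w (k n) ≤ w (k (n + 1))) ∧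
      ¬Summable fun n => w (k n) / 480 ^ (k n) := by
  have hgeom : Summable fun k : ℕ => ((1 : ℝ) / 480) ^ k :=
    summable_geometric_of_lt_one (by norm_num) (by norm_num)
  have heq : ∀ (c : ℝ) (k : ℕ), c / 480 ^ k = c * ((1 : ℝ) / 480) ^ k := by
    intro c k; rw [one_div, inv_pow, div_eq_mul_inv]
  have hunb : ∀ C, ∃ k, C ≤ w k := by
    intro C
    by_contra hcon
    push Not at hcon
    apply hdiv
    refine Summable.of_nonneg_of_le (fun k => div_nonneg (hw0 k) (by positivity)) (fun k => ?_)
      (hgeom.mul_left C)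
    rw [heq]
    gcongr
    exact (hcon k).le
  obtain ⟨k₀, hk₀⟩ := hunb 1
  classical
  let f : ℕ → ℕ := fun k => Nat.find (hunb (240 * w k))
  have hf : ∀ k, 240 * w k ≤ w (f k) := fun k => Nat.find_spec (hunb (240 * w k))
  have hf' : ∀ k j, j < f k → w j ≤ 240 * w k := fun k j hj =>
    (not_le.1 (Nat.find_min (hunb (240 * w k)) hj)).le
  let k : ℕ → ℕ := fun n => f^[n] k₀
  have hk1 : ∀ n, k (n + 1) = f (k n) := fun n => Function.iterate_succ_apply' f n k₀
  have hpos : ∀ n, 0 < w (k n) := by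
    intro n
    induction n with
    | zero => exact lt_of_lt_of_le one_pos hk₀
    | succ n ih => rw [hk1]; linarith [hf (k n)]
  have hmono : StrictMono k := by
    refine strictMono_nat_of_lt_succ fun n => ?_
    by_contra hcon
    have := hw (not_lt.1 hcon)
    rw [hk1] at this
    linarith [hf (k n), hpos n]
  refine ⟨k, hmono, hpos, fun n => by rw [hk1]; exact hf _, fun hs => hdiv ?_⟩
  have hblock : ∀ n, ∑ j ∈ Finset.Ico (k n) (k (n + 1)), w j / 480 ^ j ≤
      480 * 2 * (w (k n) / 480 ^ (k n)) := by
    intro n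
    calc ∑ j ∈ Finset.Ico (k n) (k (n + 1)), w j / 480 ^ j
        ≤ ∑ j ∈ Finset.Ico (k n) (k (n + 1)), 240 * w (k n) * ((1 : ℝ) / 480) ^ j := by
          refine Finset.sum_le_sum fun j hj => ?_
          rw [heq]
          gcongr
          exact hf' _ _ (by rw [← hk1]; exact (Finset.mem_Ico.1 hj).2)
      _ ≤ 240 * w (k n) * (((1 : ℝ) / 480) ^ (k n) / (1 - 1 / 480)) := by
          rw [← Finset.mul_sum]
          have := (hpos n).le
          gcongr
          exact geom_sum_Ico_le_of_lt_one (by norm_num) (by norm_num)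
      _ ≤ _ := by
          rw [heq]
          have : 0 ≤ w (k n) * ((1 : ℝ) / 480) ^ (k n) := by have := (hpos n).le; positivity
          have e : 240 * w (k n) * (((1 : ℝ) / 480) ^ (k n) / (1 - 1 / 480)) =
            (240 / (1 - 1 / 480)) * (w (k n) * ((1 : ℝ) / 480) ^ (k n)) := by ring
          rw [e]
          gcongr
          norm_num
  have hsum : ∀ n, ∑ j ∈ Finset.range (k n), w j / 480 ^ j ≤
      ∑ j ∈ Finset.range (k 0), w j / 480 ^ j +
        ∑ i ∈ Finset.range n, 480 * 2 * (w (k i) / 480 ^ (k i)) := by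
    intro n
    induction n with
    | zero => simp
    | succ n ih =>
      rw [Finset.sum_range_succ _ n,
        ← Finset.sum_range_add_sum_Ico _ (hmono (Nat.lt_succ_self n)).le]
      linarith [hblock n]
  have hs' := hs.mul_left (480 * 2)
  refine summable_of_sum_range_le (c := ∑ j ∈ Finset.range (k 0), w j / 480 ^ j +
    ∑' i, 480 * 2 * (w (k i) / 480 ^ (k i))) (fun j => div_nonneg (hw0 j) (by positivity))
    fun n => ?_
  calc ∑ j ∈ Finset.range n, w j / 480 ^ j ≤ ∑ j ∈ Finset.range (k n), w j / 480 ^ j := by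
        refine Finset.sum_le_sum_of_subset_of_nonneg
          (Finset.range_subset_range.2 (hmono.le_apply)) fun j _ _ =>
            div_nonneg (hw0 j) (by positivity)
    _ ≤ _ := hsum n
    _ ≤ _ := by
        gcongr
        exact hs'.sum_le_tsum _ fun i _ => by have := (hpos i).le; positivity

/-- Summability of the capped terms would force them below 1 eventually, where the cap is inactive.
The cap keeps the widths l/T bounded, as the density condition requires. -/
theorem not_summable_min {w : ℕ → ℝ} (hdiv : ¬Summable fun k => w k / 480 ^ k) :
    ¬Summable fun k => min (w k) (480 ^ k) / 480 ^ k := by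
  intro hs
  apply hdiv
  have h1 := hs.tendsto_atTop_zero.eventually (gt_mem_nhds zero_lt_one)
  refine (summable_congr_atTop ?_).1 hs
  filter_upwards [h1] with k hk
  rw [div_lt_one (by positivity)] at hk
  rcases min_lt_iff.1 hk with h | h
  · rw [min_eq_left h.le]
  · exact absurd h (lt_irrefl _)

/-- **Beurling's theorem** for the measure `h dν`, with the tail condition sampled along a geometric
progression. -/
theorem integral_eq_zero_of_tail {ν : Measure ℝ} [IsFiniteMeasure ν] {h : ℝ → ℂ}
    (hm : Measurable h) (hb : ∀ t, ‖h t‖ ≤ 1) {w : ℕ → ℝ} (hw : Monotone w) (hw0 : ∀ k, 0 ≤ w k)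
    (hdiv : ¬Summable fun k => w k / 480 ^ k) {M : ℝ}
    (hV : ∀ k : ℕ, ν.real (Ici (480 ^ k : ℝ)) ≤ M * Real.exp (-w k)) {E : Set ℝ}
    (hE : MeasurableSet E) (hpos : 0 < volume E)
    (hFE : ∀ ξ ∈ E, ∫ t : ℝ, Complex.exp (-(Complex.I * t * ξ)) * h t ∂ν = 0) (ξ : ℝ) :
    ∫ t : ℝ, Complex.exp (-(Complex.I * t * ξ)) * h t ∂ν = 0 := by
  obtain ⟨x₀, ρ, hρ, hdens⟩ := exists_density_point hpos
  -- Scaling by κ ≤ ρ brings every interval v k/(240 · 480^k) into the range (0, ρ] where the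
  -- density estimate holds; κ ≤ 1 keeps v below w.
  set κ := min 1 ρ with hκ
  have hκ0 : 0 < κ := lt_min one_pos hρ
  set v : ℕ → ℝ := fun k => κ * min (w k) (480 ^ k) with hv
  have hmin0 : ∀ k, 0 ≤ min (w k) (480 ^ k) := fun k => le_min (hw0 k) (by positivity)
  have hvmono : Monotone v := by
    intro i j hij
    simp only [hv]
    gcongr
    · exact hw hij
    · norm_num
  have hv0 : ∀ k, 0 ≤ v k := fun k => mul_nonneg hκ0.le (hmin0 k)
  have hvdiv : ¬Summable fun k => v k / 480 ^ k := by
    intro hs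
    apply not_summable_min hdiv
    refine (hs.mul_left κ⁻¹).congr fun k => ?_
    simp only [hv]
    field_simp
  have hvw : ∀ k, v k ≤ w k := fun k =>
    (mul_le_of_le_one_left (hmin0 k) (min_le_left _ _)).trans (min_le_left _ _)
  have hvρ : ∀ k, v k / (240 * 480 ^ k) ≤ ρ := by
    intro k
    rw [div_le_iff₀ (by positivity)]
    calc v k ≤ ρ * 480 ^ k := by
          simp only [hv]
          exact mul_le_mul (min_le_right _ _) (min_le_right _ _) (hmin0 k) hρ.le
      _ ≤ _ := by
          have : (0 : ℝ) ≤ 480 ^ k := by positivity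
          nlinarith [mul_nonneg hρ.le this]
  obtain ⟨k, hk, hkpos, hkl, hkdiv⟩ := exists_sparse_subsequence hvmono hv0 hvdiv
  set M' := max (max M 1) (ν.real univ) with hM'
  have hM'0 : 0 < M' := lt_max_of_lt_left (lt_max_of_lt_right one_pos)
  refine integral_eq_zero_of_sequences hm hb (M := M') (x₀ := x₀) hM'0 (le_max_right _ _)
    (T := fun n => 480 ^ (k n)) (l := fun n => v (k n)) (fun n => by positivity) hkpos (fun n => ?_)
    hkl hkdiv (fun n => ?_) hE hFE (fun n => ?_) ξ
  · rw [← pow_succ']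
    exact pow_le_pow_right₀ (by norm_num) (hk (Nat.lt_succ_self n))
  · refine (hV (k n)).trans ?_
    have : M ≤ M' := (le_max_left _ _).trans (le_max_left _ _)
    gcongr
    exact hvw _
  · exact hdens _ (by have := hkpos n; positivity) (hvρ _)

/-! ### Polar decomposition and uniqueness for Fourier transforms of complex measures. -/

theorem isFiniteMeasure_variation {X : Type*} [MeasurableSpace X] (μ : ComplexMeasure X) :
    IsFiniteMeasure (VectorMeasure.variation μ) := by
  have h1 : IsFiniteMeasure (VectorMeasure.variation (ComplexMeasure.re μ)) := by
    rw [← SignedMeasure.totalVariation_eq_variation]; infer_instance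
  have h2 : IsFiniteMeasure (VectorMeasure.variation (ComplexMeasure.im μ)) := by
    rw [← SignedMeasure.totalVariation_eq_variation]; infer_instance
  refine isFiniteMeasure_of_le (VectorMeasure.variation (ComplexMeasure.re μ) +
    VectorMeasure.variation (ComplexMeasure.im μ)) ?_
  refine VectorMeasure.variation_le_of_forall_enorm_le fun E _ => ?_
  have h3 : ‖μ E‖ₑ ≤ ‖(μ E).re‖ₑ + ‖(μ E).im‖ₑ := by
    rw [← ofReal_norm, ← ofReal_norm, ← ofReal_norm,
      ← ENNReal.ofReal_add (norm_nonneg _) (norm_nonneg _)]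
    exact ENNReal.ofReal_le_ofReal (Complex.norm_le_abs_re_add_abs_im _)
  refine h3.trans ?_
  rw [Measure.add_apply]
  exact add_le_add (VectorMeasure.enorm_measure_le_variation (ComplexMeasure.re μ) E)
    (VectorMeasure.enorm_measure_le_variation (ComplexMeasure.im μ) E)

/-- Polar decomposition of a complex measure. -/
theorem exists_density {X : Type*} [MeasurableSpace X] (μ : ComplexMeasure X) :
    ∃ h : X → ℂ, Measurable h ∧ (∀ x, ‖h x‖ ≤ 1) ∧
      (VectorMeasure.variation μ).withDensityᵥ h = μ := by
  have hfin := isFiniteMeasure_variation μ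
  set ν := VectorMeasure.variation μ with hν
  have hac : ∀ s, MeasurableSet s → ν s = 0 → μ s = 0 := by
    intro s _ hs
    have := VectorMeasure.enorm_measure_le_variation μ s
    rw [← hν, hs] at this
    simpa using this
  have hre : ComplexMeasure.re μ ≪ᵥ ν.toENNRealVectorMeasure := by
    refine VectorMeasure.AbsolutelyContinuous.mk fun s hs h0 => ?_
    rw [Measure.toENNRealVectorMeasure_apply_measurable hs] at h0
    change (μ s).re = 0
    rw [hac s hs h0]; rfl
  have him : ComplexMeasure.im μ ≪ᵥ ν.toENNRealVectorMeasure := by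
    refine VectorMeasure.AbsolutelyContinuous.mk fun s hs h0 => ?_
    rw [Measure.toENNRealVectorMeasure_apply_measurable hs] at h0
    change (μ s).im = 0
    rw [hac s hs h0]; rfl
  have hre' := SignedMeasure.withDensityᵥ_rnDeriv_eq _ ν hre
  have him' := SignedMeasure.withDensityᵥ_rnDeriv_eq _ ν him
  set g : X → ℂ := ComplexMeasure.rnDeriv μ ν with hg
  have hgi : Integrable g ν := ComplexMeasure.integrable_rnDeriv μ ν
  have hgμ : ν.withDensityᵥ g = μ := by
    ext s hs
    rw [withDensityᵥ_apply hgi hs]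
    apply Complex.ext
    · have h1 := congrArg (fun m : SignedMeasure X => m s) hre'
      simp only [withDensityᵥ_apply (SignedMeasure.integrable_rnDeriv _ _) hs] at h1
      have h2 := integral_re hgi.integrableOn (μ := ν.restrict s)
      simp only [RCLike.re_to_complex] at h2
      rw [← h2]
      exact h1
    · have h1 := congrArg (fun m : SignedMeasure X => m s) him'
      simp only [withDensityᵥ_apply (SignedMeasure.integrable_rnDeriv _ _) hs] at h1
      have h2 := integral_im hgi.integrableOn (μ := ν.restrict s)
      simp only [RCLike.im_to_complex] at h2
      rw [← h2]
      exact h1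
  have hgm : Measurable g := by
    have h1 := SignedMeasure.measurable_rnDeriv (ComplexMeasure.re μ) ν
    have h2 := SignedMeasure.measurable_rnDeriv (ComplexMeasure.im μ) ν
    exact measurable_of_re_im h1 h2
  -- The variation of g dν is |g| dν; here it equals ν, so |g| = 1 almost everywhere.
  have hnorm : ∀ᵐ x ∂ν, ‖g x‖ ≤ 1 := by
    have h1 := Measure.variation_withDensityᵥ hgi
    rw [hgμ, ← hν] at h1
    have h2 : ν.withDensity (fun x => ‖g x‖ₑ) = ν.withDensity 1 := by
      rw [← h1, withDensity_one]
    rw [withDensity_eq_iff_of_sigmaFinite (by fun_prop) (by fun_prop)] at h2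
    filter_upwards [h2] with x hx
    have h3 : ‖g x‖ₑ ≤ 1 := hx.le
    simpa using ENNReal.toReal_mono ENNReal.one_ne_top h3
  set h : X → ℂ := {x | ‖g x‖ ≤ 1}.indicator g with hh
  have hgh : h =ᵐ[ν] g := by
    filter_upwards [hnorm] with x hx
    exact indicator_of_mem (s := {x | ‖g x‖ ≤ 1}) hx g
  refine ⟨h, hgm.indicator (measurableSet_le hgm.norm measurable_const), fun x => ?_, ?_⟩
  · by_cases hx : ‖g x‖ ≤ 1
    · rw [hh, indicator_of_mem (s := {x | ‖g x‖ ≤ 1}) hx]; exact hx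
    · rw [hh, indicator_of_notMem (s := {x | ‖g x‖ ≤ 1}) hx]; simp
  · rw [WithDensityᵥEq.congr_ae hgh, hgμ]

/-- Both sides are additive and continuous in L¹(|μ|) and agree on indicators, so density of simple
functions suffices. -/
theorem cintegral_eq_integral_mul {X : Type*} [MeasurableSpace X] {μ : ComplexMeasure X} {h : X → ℂ}
    (hm : Measurable h) (hb : ∀ x, ‖h x‖ ≤ 1)
    (hμ : (VectorMeasure.variation μ).withDensityᵥ h = μ) {f : X → ℂ}
    (hf : Integrable f (VectorMeasure.variation μ)) :
    cintegral μ f = ∫ x, f x * h x ∂(VectorMeasure.variation μ) := by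
  have hfin := isFiniteMeasure_variation μ
  set ν := VectorMeasure.variation μ with hν
  have hhi : Integrable h ν := Integrable.of_bound hm.aestronglyMeasurable 1 (Eventually.of_forall hb)
  have hmul : ∀ {f : X → ℂ}, Integrable f ν → Integrable (fun x => f x * h x) ν := fun hf =>
    hf.mul_bdd (c := 1) hm.aestronglyMeasurable (Eventually.of_forall hb)
  refine Integrable.induction (fun f : X → ℂ => cintegral μ f = ∫ x, f x * h x ∂ν)
    (fun c s hs _ => ?_) (fun f g _ hf hg h1 h2 => ?_) ?_ (fun f g hfg _ h1 => ?_) hf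
  · have h1 : cintegral μ (s.indicator fun _ => c) = c * μ s :=
      VectorMeasure.integral_indicator_const c hs
    rw [h1]
    have h2 : ∀ x, s.indicator (fun _ => c) x * h x = s.indicator (fun x => c * h x) x := by
      intro x
      by_cases hx : x ∈ s <;> simp [hx]
    simp_rw [h2]
    rw [integral_indicator hs, integral_const_mul, ← withDensityᵥ_apply hhi hs, hμ]
  · have h3 : cintegral μ (f + g) = cintegral μ f + cintegral μ g :=
      VectorMeasure.integral_add (μ := μ) hf hg
    rw [h3, h1, h2, ← integral_add (hmul hf) (hmul hg)]
    simp [add_mul]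
  · have hc1 : Continuous fun f : X →₁[ν] ℂ => cintegral μ f :=
      VectorMeasure.continuous_integral (μ := μ)
    have hc2 : Continuous fun f : X →₁[ν] ℂ => ∫ x, f x * h x ∂ν := by
      refine continuous_iff_continuousAt.2 fun f => ?_
      refine tendsto_iff_norm_sub_tendsto_zero.2 ?_
      have h0 : Tendsto (fun g : X →₁[ν] ℂ => ‖g - f‖) (𝓝 f) (𝓝 0) :=
        tendsto_iff_norm_sub_tendsto_zero.1 tendsto_id
      refine squeeze_zero (fun _ => norm_nonneg _) (fun g => ?_) h0
      rw [← integral_sub (hmul (L1.integrable_coeFn g)) (hmul (L1.integrable_coeFn f)),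
        L1.norm_eq_integral_norm]
      have hsub : ∫ a, ‖(g - f : X →₁[ν] ℂ) a‖ ∂ν = ∫ a, ‖g a - f a‖ ∂ν := by
        refine integral_congr_ae ?_
        filter_upwards [Lp.coeFn_sub g f] with a ha
        rw [ha]; rfl
      rw [hsub]
      refine norm_integral_le_of_norm_le
        ((L1.integrable_coeFn g).sub (L1.integrable_coeFn f)).norm (Eventually.of_forall fun x => ?_)
      rw [← sub_mul, norm_mul]
      exact mul_le_of_le_one_right (norm_nonneg _) (hb x)
    exact isClosed_eq hc1 hc2
  · have h2 : cintegral μ f = cintegral μ g := VectorMeasure.integral_congr_ae hfg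
    rw [← h2, h1]
    refine integral_congr_ae ?_
    filter_upwards [hfg] with x hx
    rw [hx]

/-- The positive measures r⁺ν and r⁻ν have equal integrals against every e i, so a uniqueness
theorem for finite positive measures identifies them. -/
theorem ae_eq_zero_of_integral_mul_real_eq_zero {X ι : Type*} [MeasurableSpace X] {ν : Measure X}
    [IsFiniteMeasure ν] {e : ι → X → ℂ} (he : ∀ i, Measurable (e i)) (he1 : ∀ i x, ‖e i x‖ ≤ 1)
    (hext : ∀ P P' : Measure X, IsFiniteMeasure P → IsFiniteMeasure P' →
      (∀ i, ∫ x, e i x ∂P = ∫ x, e i x ∂P') → P = P')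
    {r : X → ℝ} (hr : Measurable r) (hr1 : ∀ x, |r x| ≤ 1)
    (h0 : ∀ i, ∫ x, e i x * (r x : ℂ) ∂ν = 0) : r =ᵐ[ν] 0 := by
  have hri : Integrable r ν := Integrable.of_bound hr.aestronglyMeasurable 1 (Eventually.of_forall hr1)
  have hP := isFiniteMeasure_withDensity_ofReal hri.2
  have hP' := isFiniteMeasure_withDensity_ofReal hri.neg.2
  have hint : ∀ (s : X → ℝ), Measurable s → ∀ i,
      ∫ x, e i x ∂(ν.withDensity fun x => ENNReal.ofReal (s x)) =
        ∫ x, (max (s x) 0 : ℝ) * e i x ∂ν := by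
    intro s hs i
    rw [integral_withDensity_eq_integral_toReal_smul (by fun_prop)
      (Eventually.of_forall fun _ => ENNReal.ofReal_lt_top)]
    refine integral_congr_ae (Eventually.of_forall fun x => ?_)
    change (ENNReal.ofReal (s x)).toReal • e i x = _
    rw [ENNReal.toReal_ofReal', Complex.real_smul]
  have hmi : ∀ (s : X → ℝ), Measurable s → (∀ x, |s x| ≤ 1) → ∀ i,
      Integrable (fun x => ((max (s x) 0 : ℝ) : ℂ) * e i x) ν := by
    intro s hs hs1 i
    have := he i
    refine Integrable.of_bound (Measurable.aestronglyMeasurable (by fun_prop)) 1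
      (Eventually.of_forall fun x => ?_)
    rw [norm_mul, Complex.norm_real]
    refine mul_le_one₀ ?_ (norm_nonneg _) (he1 i x)
    rw [Real.norm_eq_abs, abs_of_nonneg (le_max_right _ _)]
    exact max_le ((le_abs_self _).trans (hs1 x)) zero_le_one
  have hPP := hext _ _ hP hP' fun i => by
    have hn : (fun x => ENNReal.ofReal ((-r) x)) = fun x => ENNReal.ofReal (-r x) := rfl
    rw [hint r hr i, hint (-r) hr.neg i, ← sub_eq_zero,
      ← integral_sub (hmi r hr hr1 i) (hmi (-r) hr.neg (by simpa using hr1) i), ← h0 i]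
    refine integral_congr_ae (Eventually.of_forall fun x => ?_)
    change ((max (r x) 0 : ℝ) : ℂ) * e i x - ((max (-r x) 0 : ℝ) : ℂ) * e i x = e i x * (r x : ℂ)
    rw [← sub_mul, ← Complex.ofReal_sub, mul_comm (e i x)]
    congr 2
    rcases le_total 0 (r x) with h | h
    · rw [max_eq_left h, max_eq_right (by linarith)]; ring
    · rw [max_eq_right h, max_eq_left (by linarith)]; ring
  refine hri.ae_eq_of_withDensityᵥ_eq (integrable_zero _ _ _) ?_
  rw [withDensityᵥ_eq_withDensity_pos_part_sub_withDensity_neg_part hri, withDensityᵥ_zero,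
    sub_eq_zero]
  ext s hs
  rw [Measure.toSignedMeasure_apply_measurable hs, Measure.toSignedMeasure_apply_measurable hs, hPP]
  rfl

/-- Closure of the family under conjugation makes it annihilate the conjugate of h too, hence its
real and imaginary parts. -/
theorem ae_eq_zero_of_integral_mul_eq_zero {X ι : Type*} [MeasurableSpace X] {ν : Measure X}
    [IsFiniteMeasure ν] {e : ι → X → ℂ} (he : ∀ i, Measurable (e i)) (he1 : ∀ i x, ‖e i x‖ ≤ 1)
    (hconj : ∀ i, ∃ j, ∀ x, e j x = starRingEnd ℂ (e i x))
    (hext : ∀ P P' : Measure X, IsFiniteMeasure P → IsFiniteMeasure P' →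
      (∀ i, ∫ x, e i x ∂P = ∫ x, e i x ∂P') → P = P')
    {h : X → ℂ} (hm : Measurable h) (hb : ∀ x, ‖h x‖ ≤ 1)
    (h0 : ∀ i, ∫ x, e i x * h x ∂ν = 0) : h =ᵐ[ν] 0 := by
  have hint : ∀ {f : X → ℂ}, Measurable f → (∀ x, ‖f x‖ ≤ 1) → ∀ i,
      Integrable (fun x => e i x * f x) ν := by
    intro f hf hf1 i
    have := he i
    refine Integrable.of_bound (Measurable.aestronglyMeasurable (by fun_prop)) 1
      (Eventually.of_forall fun x => ?_)
    rw [norm_mul]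
    exact mul_le_one₀ (he1 i x) (norm_nonneg _) (hf1 x)
  have hcm : Measurable fun x => starRingEnd ℂ (h x) := Complex.continuous_conj.measurable.comp hm
  have hc : ∀ i, ∫ x, e i x * starRingEnd ℂ (h x) ∂ν = 0 := by
    intro i
    obtain ⟨j, hj⟩ := hconj i
    have h1 := congrArg (starRingEnd ℂ) (h0 j)
    rw [← integral_conj, map_zero] at h1
    rw [← h1]
    refine integral_congr_ae (Eventually.of_forall fun x => ?_)
    simp only [map_mul, hj, Complex.conj_conj]
  have hcb : ∀ x, ‖starRingEnd ℂ (h x)‖ ≤ 1 := fun x => by simpa using hb x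
  have hre := ae_eq_zero_of_integral_mul_real_eq_zero (ν := ν) he he1 hext
    (r := fun x => (h x).re) (by fun_prop) (fun x => (Complex.abs_re_le_norm _).trans (hb x))
    fun i => by
      have h1 : ∀ x, e i x * ((h x).re : ℂ) =
          2⁻¹ * (e i x * h x + e i x * starRingEnd ℂ (h x)) := by
        intro x
        rw [← mul_add, Complex.add_conj]; push_cast; ring
      simp_rw [h1]
      rw [integral_const_mul, integral_add (hint hm hb i) (hint hcm hcb i), h0, hc]
      simp
  have him := ae_eq_zero_of_integral_mul_real_eq_zero (ν := ν) he he1 hext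
    (r := fun x => (h x).im) (by fun_prop) (fun x => (Complex.abs_im_le_norm _).trans (hb x))
    fun i => by
      have h1 : ∀ x, e i x * ((h x).im : ℂ) =
          (2 * Complex.I)⁻¹ * (e i x * h x - e i x * starRingEnd ℂ (h x)) := by
        intro x
        rw [← mul_sub, Complex.sub_conj]
        field_simp
        push_cast
        ring
      simp_rw [h1]
      rw [integral_const_mul, integral_sub (hint hm hb i) (hint hcm hcb i), h0, hc]
      simp
  filter_upwards [hre, him] with x h1 h2
  exact Complex.ext h1 h2

theorem ae_eq_zero_of_fourier_real_eq_zero {ν : Measure ℝ} [IsFiniteMeasure ν] {h : ℝ → ℂ}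
    (hm : Measurable h) (hb : ∀ x, ‖h x‖ ≤ 1)
    (h0 : ∀ ξ : ℝ, ∫ t : ℝ, Complex.exp (-(Complex.I * t * ξ)) * h t ∂ν = 0) : h =ᵐ[ν] 0 := by
  refine ae_eq_zero_of_integral_mul_eq_zero
    (e := fun (ξ t : ℝ) => Complex.exp (-(Complex.I * t * ξ))) (fun ξ => by fun_prop)
    (fun ξ t => ?_) (fun ξ => ⟨-ξ, fun t => ?_⟩) (fun P P' hP hP' hPP => ?_) hm hb h0
  · rw [Complex.norm_exp]; simp
  · rw [← Complex.exp_conj]; simp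
  · refine Measure.ext_of_charFun (funext fun ξ => ?_)
    rw [charFun_apply_real, charFun_apply_real]
    have := hPP (-ξ)
    convert this using 3 with t t
    · congr 1; push_cast; ring
    · congr 1; push_cast; ring

theorem continuous_circle_zpow (n : ℤ) : Continuous fun ζ : Circle => (ζ : ℂ) ^ n :=
  continuous_subtype_val.zpow₀ _ fun ζ => Or.inl (Circle.coe_ne_zero ζ)

theorem ae_eq_zero_of_fourier_circle_eq_zero {ν : Measure Circle} [IsFiniteMeasure ν]
    {h : Circle → ℂ} (hm : Measurable h) (hb : ∀ x, ‖h x‖ ≤ 1)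
    (h0 : ∀ n : ℤ, ∫ ζ : Circle, (ζ : ℂ) ^ (-n) * h ζ ∂ν = 0) : h =ᵐ[ν] 0 := by
  refine ae_eq_zero_of_integral_mul_eq_zero
    (e := fun (n : ℤ) (ζ : Circle) => (ζ : ℂ) ^ (-n)) (fun n => (continuous_circle_zpow _).measurable)
    (fun n ζ => ?_) (fun n => ⟨-n, fun ζ => ?_⟩) (fun P P' hP hP' hPP => ?_) hm hb h0
  · rw [norm_zpow, Circle.norm_coe, one_zpow]
  · rw [map_zpow₀, ← Circle.coe_inv_eq_conj, Circle.coe_inv, inv_zpow, zpow_neg]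
  · have hpos : Fact (0 < 2 * Real.pi) := ⟨by positivity⟩
    let e := AddCircle.homeomorphCircle'
    let Φ : (P : Measure Circle) → C(AddCircle (2 * Real.pi), ℂ) → ℂ := fun P f =>
      ∫ ζ, f (e.symm ζ) ∂P
    have hint : ∀ (P : Measure Circle), IsFiniteMeasure P → ∀ f : C(AddCircle (2 * Real.pi), ℂ),
        Integrable (fun ζ => f (e.symm ζ)) P := by
      intro P hP f
      exact Integrable.of_bound
        (f.continuous.comp e.symm.continuous).measurable.aestronglyMeasurable ‖f‖
        (Eventually.of_forall fun ζ => f.norm_coe_le_norm _)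
    have hΦc : ∀ (P : Measure Circle), IsFiniteMeasure P → Continuous (Φ P) := by
      intro P hP
      refine continuous_iff_continuousAt.2 fun f => tendsto_iff_norm_sub_tendsto_zero.2 ?_
      have h0 : Tendsto (fun g : C(AddCircle (2 * Real.pi), ℂ) => ‖g - f‖ * P.real univ) (𝓝 f)
          (𝓝 (0 * P.real univ)) :=
        (tendsto_iff_norm_sub_tendsto_zero.1 tendsto_id).mul_const _
      rw [zero_mul] at h0
      refine squeeze_zero (fun _ => norm_nonneg _) (fun g => ?_) h0
      simp only [Φ]
      rw [← integral_sub (hint P hP g) (hint P hP f)]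
      refine norm_integral_le_of_norm_le_const (Eventually.of_forall fun ζ => ?_)
      exact (g - f).norm_coe_le_norm _
    -- The functions on which P and P' agree form a closed subspace containing the characters, hence
    -- everything by the density of trigonometric polynomials.
    let S : Submodule ℂ C(AddCircle (2 * Real.pi), ℂ) :=
      { carrier := {f | Φ P f = Φ P' f}
        add_mem' := fun {f g} hf hg => by
          have hf : Φ P f = Φ P' f := hf
          have hg : Φ P g = Φ P' g := hg
          have hadd : ∀ (P : Measure Circle), IsFiniteMeasure P → Φ P (f + g) = Φ P f + Φ P g :=
            fun P hP => integral_add (hint P hP f) (hint P hP g)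
          change Φ P (f + g) = Φ P' (f + g)
          rw [hadd P hP, hadd P' hP', hf, hg]
        zero_mem' := by simp [Φ]
        smul_mem' := fun c f hf => by
          have hf : Φ P f = Φ P' f := hf
          have hsm : ∀ (P : Measure Circle), Φ P (c • f) = c * Φ P f :=
            fun P => integral_const_mul c _
          change Φ P (c • f) = Φ P' (c • f)
          rw [hsm, hsm, hf] }
    have hSc : IsClosed (S : Set C(AddCircle (2 * Real.pi), ℂ)) :=
      isClosed_eq (hΦc P hP) (hΦc P' hP')
    have hSt : S = ⊤ := by
      rw [eq_top_iff, ← span_fourier_closure_eq_top]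
      refine Submodule.topologicalClosure_minimal _ (Submodule.span_le.2 ?_) hSc
      rintro _ ⟨n, rfl⟩
      have hfe : ∀ ζ : Circle, fourier n (e.symm ζ) = (ζ : ℂ) ^ (- -n) := by
        intro ζ
        obtain ⟨x, rfl⟩ := e.surjective ζ
        rw [e.symm_apply_apply, fourier_apply, AddCircle.toCircle_zsmul, neg_neg, Circle.coe_zpow]
        congr 2
        induction x using QuotientAddGroup.induction_on with
        | H x =>
          rw [AddCircle.toCircle_apply_mk, AddCircle.homeomorphCircle'_apply_mk,
            div_self (by positivity), one_mul]
      change ∫ ζ, fourier n (e.symm ζ) ∂P = ∫ ζ, fourier n (e.symm ζ) ∂P'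
      simp_rw [hfe]
      exact hPP (-n)
    refine ext_of_forall_integral_eq_of_IsFiniteMeasure fun f => ?_
    let g : C(AddCircle (2 * Real.pi), ℂ) :=
      ⟨fun x => (f (e x) : ℂ), Complex.continuous_ofReal.comp (f.continuous.comp e.continuous)⟩
    have hg : g ∈ S := hSt ▸ Submodule.mem_top
    have hg : ∫ ζ, ((f (e (e.symm ζ)) : ℝ) : ℂ) ∂P = ∫ ζ, ((f (e (e.symm ζ)) : ℝ) : ℂ) ∂P' := hg
    simp_rw [e.apply_symm_apply] at hg
    rw [integral_complex_ofReal, integral_complex_ofReal] at hg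
    exact_mod_cast hg

/-! ### From the logarithmic integral to a divergent sum; Beurling's theorem. -/

/-- The positive part of `-log x`. -/
noncomputable def negLog (x : ENNReal) : ENNReal := (-ENNReal.log x).toENNReal

theorem negLog_antitone : Antitone negLog := fun _ _ h =>
  EReal.toENNReal_le_toENNReal (EReal.neg_le_neg_iff.2 (ENNReal.log_monotone h))

theorem toENNReal_neg_log_div {x : ENNReal} {c : ℝ} (hc : 0 < c) :
    (-(ENNReal.log x / (c : EReal))).toENNReal = negLog x * ENNReal.ofReal c⁻¹ := by
  rw [div_eq_mul_inv, ← EReal.coe_inv, ← EReal.neg_mul, EReal.toENNReal_mul' (by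
    exact_mod_cast (inv_pos.2 hc).le), EReal.real_coe_toENNReal, negLog]

/-- Since `negLog` vanishes above 1, the factor `max 1 x.toReal` is needed to cover the case c = 0
with x > 1. -/
theorem toReal_le_mul_exp_neg {x : ENNReal} (hx : x ≠ ⊤) {c : ℝ} (hc : 0 ≤ c)
    (hcx : ENNReal.ofReal c ≤ negLog x) : x.toReal ≤ max 1 x.toReal * Real.exp (-c) := by
  rcases eq_or_ne x 0 with rfl | hx0
  · simpa using (Real.exp_pos _).le
  have hpos : 0 < x.toReal := ENNReal.toReal_pos hx0 hx
  rw [negLog, ENNReal.log_pos_real hx0 hx, ← EReal.coe_neg, EReal.real_coe_toENNReal] at hcx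
  rcases hc.eq_or_lt with rfl | hc
  · simp
  have h1 : c ≤ -Real.log x.toReal := by
    rcases ENNReal.ofReal_le_ofReal_iff'.1 hcx with h | h <;> linarith
  calc x.toReal = Real.exp (Real.log x.toReal) := (Real.exp_log hpos).symm
    _ ≤ Real.exp (-c) := Real.exp_le_exp.2 (by linarith)
    _ ≤ max 1 x.toReal * Real.exp (-c) :=
      le_mul_of_one_le_left (Real.exp_pos _).le (le_max_left _ _)

/-- Condensation: the logarithmic integral of a decreasing function is controlled by the sum of its
values along a geometric progression. -/
theorem lintegral_neg_log_div_le {V : ℝ → ENNReal} (hV : Antitone V) :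
    ∫⁻ t in Ioi (0 : ℝ), (-(ENNReal.log (V t) / ((1 + t ^ 2 : ℝ) : EReal))).toENNReal ≤
      negLog (V 1) + ∑' k : ℕ, negLog (V (480 ^ (k + 1))) * ENNReal.ofReal (480 / 480 ^ k) := by
  have hcov : Ioi (0 : ℝ) ⊆ Ioc 0 1 ∪ ⋃ k : ℕ, Ico ((480 : ℝ) ^ k) (480 ^ (k + 1)) := by
    intro t ht
    rcases le_or_gt t 1 with h | h
    · exact Or.inl ⟨ht, h⟩
    · obtain ⟨n, hn⟩ := exists_nat_pow_near h.le (by norm_num : (1 : ℝ) < 480)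
      exact Or.inr (mem_iUnion.2 ⟨n, hn⟩)
  refine (lintegral_mono_set hcov).trans ((lintegral_union_le _ _ _).trans (add_le_add ?_ ?_))
  · refine (setLIntegral_mono' measurableSet_Ioc (g := fun _ => negLog (V 1))
      fun t ht => ?_).trans ?_
    · rw [toENNReal_neg_log_div (by positivity)]
      refine (mul_le_mul' (negLog_antitone (hV ht.2))
        (ENNReal.ofReal_le_one.2 (inv_le_one_of_one_le₀ ?_))).trans (mul_one _).le
      nlinarith [sq_nonneg t]
    · simp
  · refine (lintegral_iUnion_le _ _).trans (ENNReal.tsum_le_tsum fun k => ?_)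
    have hp : (0 : ℝ) < 480 ^ k := by positivity
    refine (setLIntegral_mono' measurableSet_Ico
      (g := fun _ => negLog (V (480 ^ (k + 1))) * ENNReal.ofReal (((480 : ℝ) ^ k * 480 ^ k)⁻¹))
      fun t ht => ?_).trans ?_
    · rw [toENNReal_neg_log_div (by positivity)]
      refine mul_le_mul' (negLog_antitone (hV ht.2.le)) (ENNReal.ofReal_le_ofReal ?_)
      refine inv_anti₀ (by positivity) ?_
      nlinarith [ht.1]
    · rw [setLIntegral_const, Real.volume_Ico, mul_assoc, ← ENNReal.ofReal_mul (by positivity)]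
      refine mul_le_mul' le_rfl (ENNReal.ofReal_le_ofReal ?_)
      rw [le_div_iff₀ hp, inv_mul_eq_div, div_mul_eq_mul_div, div_le_iff₀ (by positivity), pow_succ]
      nlinarith [mul_pos hp hp]

/-- The cap by 480^k keeps the terms meaningful when V vanishes and `negLog` is infinite.
Summability would make the cap inactive eventually, hence `negLog` finite at all scales by
monotonicity, and condensation would bound the integral. -/
theorem not_summable_of_lintegral_eq_top {V : ℝ → ENNReal} (hV : Antitone V)
    (hint : ∫⁻ t in Ioi (0 : ℝ), (-(ENNReal.log (V t) / ((1 + t ^ 2 : ℝ) : EReal))).toENNReal = ⊤) :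
    ¬Summable fun k : ℕ =>
      (min (negLog (V (480 ^ k))) (ENNReal.ofReal (480 ^ k))).toReal / 480 ^ k := by
  intro hs
  have hlt : ∀ᶠ k : ℕ in atTop, negLog (V (480 ^ k)) < ENNReal.ofReal (480 ^ k) := by
    filter_upwards [hs.tendsto_atTop_zero.eventually (gt_mem_nhds one_pos)] with k hk
    by_contra! h
    rw [min_eq_right h, ENNReal.toReal_ofReal (by positivity), div_self (by positivity)] at hk
    exact lt_irrefl _ hk
  have hmono : Monotone fun k : ℕ => negLog (V (480 ^ k)) := fun i j hij =>
    negLog_antitone (hV (pow_le_pow_right₀ (by norm_num) hij))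
  have hfin : ∀ k : ℕ, negLog (V (480 ^ k)) ≠ ⊤ := fun k => by
    obtain ⟨j, hj, hkj⟩ := (hlt.and (eventually_ge_atTop k)).exists
    exact ((hmono hkj).trans_lt (hj.trans ENNReal.ofReal_lt_top)).ne
  have hs' : Summable fun k : ℕ => (negLog (V (480 ^ k))).toReal / 480 ^ k := by
    refine (summable_congr_atTop ?_).1 hs
    filter_upwards [hlt] with k hk
    rw [min_eq_left hk.le]
  have hs2 := ((summable_nat_add_iff 1).2 hs').mul_left (480 ^ 2)
  refine absurd hint ((lintegral_neg_log_div_le hV).trans_lt ?_).ne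
  refine ENNReal.add_lt_top.2 ⟨?_, ?_⟩
  · simpa using (hfin 0).lt_top
  · rw [show (fun k : ℕ => negLog (V (480 ^ (k + 1))) * ENNReal.ofReal (480 / 480 ^ k)) =
      fun k : ℕ => ENNReal.ofReal (480 ^ 2 * ((negLog (V (480 ^ (k + 1)))).toReal / 480 ^ (k + 1)))
      from ?_]
    · exact hs2.tsum_ofReal_lt_top
    · funext k
      nth_rewrite 1 [← ENNReal.ofReal_toReal (hfin (k + 1))]
      rw [← ENNReal.ofReal_mul ENNReal.toReal_nonneg]
      congr 1
      field_simp
      ring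

theorem eq_zero_of_log_tailVariation {μ : ComplexMeasure ℝ}
    (hint : ∫⁻ t in Ioi (0 : ℝ),
      (-(ENNReal.log (tailVariation μ t) / ((1 + t ^ 2 : ℝ) : EReal))).toENNReal = ⊤)
    {E : Set ℝ} (hE : MeasurableSet E) (hpos : 0 < volume E)
    (hFE : ∀ ξ ∈ E, fourierReal μ ξ = 0) : μ = 0 := by
  have hfin := isFiniteMeasure_variation μ
  obtain ⟨h, hm, hb, hμ⟩ := exists_density μ
  have hV : Antitone (tailVariation μ) := fun s t hst => measure_mono (Ici_subset_Ici.2 hst)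
  have hVtop : ∀ t, tailVariation μ t ≠ ⊤ := fun t => measure_ne_top _ _
  have hF : ∀ ξ : ℝ, fourierReal μ ξ =
      ∫ t : ℝ, Complex.exp (-(Complex.I * t * ξ)) * h t ∂(VectorMeasure.variation μ) := fun ξ => by
    refine cintegral_eq_integral_mul hm hb hμ (Integrable.of_bound
      (Continuous.aestronglyMeasurable (by fun_prop)) 1 (Eventually.of_forall fun t => ?_))
    simp [Complex.norm_exp]
  have hmin : ∀ k : ℕ, min (negLog (tailVariation μ (480 ^ k))) (ENNReal.ofReal (480 ^ k)) ≠ ⊤ :=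
    fun k => (min_lt_of_right_lt ENNReal.ofReal_lt_top).ne
  have hzero := integral_eq_zero_of_tail (ν := VectorMeasure.variation μ) hm hb
    (w := fun k => (min (negLog (tailVariation μ (480 ^ k))) (ENNReal.ofReal (480 ^ k))).toReal)
    (fun i j hij => ENNReal.toReal_mono (hmin j) (min_le_min
      (negLog_antitone (hV (pow_le_pow_right₀ (by norm_num) hij)))
      (ENNReal.ofReal_le_ofReal (pow_le_pow_right₀ (by norm_num) hij))))
    (fun k => ENNReal.toReal_nonneg) (not_summable_of_lintegral_eq_top hV hint)
    (M := max 1 (VectorMeasure.variation μ univ).toReal) (fun k => ?_) hE hpos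
    (fun ξ hξ => (hF ξ).symm.trans (hFE ξ hξ))
  · rw [← hμ, WithDensityᵥEq.congr_ae (ae_eq_zero_of_fourier_real_eq_zero hm hb hzero),
      withDensityᵥ_zero]
  · refine (toReal_le_mul_exp_neg (hVtop (480 ^ k)) ENNReal.toReal_nonneg ?_).trans
      (mul_le_mul_of_nonneg_right (max_le_max le_rfl
        (ENNReal.toReal_mono (measure_ne_top _ _) (measure_mono (subset_univ _))))
        (Real.exp_pos _).le)
    rw [ENNReal.ofReal_toReal (hmin k)]
    exact min_le_left _ _

/-! ### The triangular bump on the circle. -/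

/-- The Fourier coefficients (up to normalization) of a triangular bump supported on the arc
`|θ| ≤ δ` of the circle. -/
noncomputable def bumpCoeff (δ : ℝ) (n : ℤ) : ℝ :=
  (2 - 2 * Real.cos (n * δ)) / (n : ℝ) ^ 2 + if n = 0 then δ ^ 2 else 0

theorem bumpCoeff_nonneg (δ : ℝ) (n : ℤ) : 0 ≤ bumpCoeff δ n := by
  have := Real.cos_le_one (n * δ)
  refine add_nonneg (div_nonneg (by linarith) (sq_nonneg _)) ?_
  split_ifs <;> positivity

theorem bumpCoeff_pos {δ : ℝ} (hδ : 0 < δ) {n : ℤ} (hn : |(n : ℝ)| * δ < 1) :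
    0 < bumpCoeff δ n := by
  rcases eq_or_ne n 0 with rfl | h0
  · simpa [bumpCoeff] using pow_pos hδ 2
  have hn0 : (n : ℝ) ≠ 0 := Int.cast_ne_zero.2 h0
  have habs : |(n : ℝ) * δ| < 1 := by rwa [abs_mul, abs_of_pos hδ]
  have hπ := Real.pi_gt_three
  have h1 : Real.cos (n * δ) ≠ 1 := fun h =>
    mul_ne_zero hn0 hδ.ne' ((Real.cos_eq_one_iff_of_lt_of_lt
      (by linarith [(abs_lt.1 habs).1]) (by linarith [(abs_lt.1 habs).2])).1 h)
  have h2 := lt_of_le_of_ne (Real.cos_le_one (n * δ)) h1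
  rw [bumpCoeff, if_neg h0, add_zero]
  have : (0 : ℝ) < (n : ℝ) ^ 2 := by positivity
  exact div_pos (by linarith) this

theorem summable_bumpCoeff (δ : ℝ) : Summable (bumpCoeff δ) := by
  refine Summable.add ?_ (summable_of_ne_finset_zero (s := {0}) fun n hn => if_neg (by simpa using hn))
  refine Summable.of_nonneg_of_le (fun n => ?_) (fun n => ?_)
    ((Real.summable_one_div_int_pow.2 one_lt_two).mul_left 4)
  · exact div_nonneg (by linarith [Real.cos_le_one (n * δ)]) (sq_nonneg _)
  · rw [mul_one_div]
    exact div_le_div_of_nonneg_right (by linarith [Real.neg_one_le_cos (n * δ)]) (sq_nonneg _)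

/-- This is the Fourier series of the second Bernoulli polynomial; the term n = 0 is 0 by the
convention for division by zero. -/
theorem hasSum_exp_div_sq {θ : ℝ} (h0 : 0 ≤ θ) (h1 : θ ≤ 2 * Real.pi) :
    HasSum (fun n : ℤ => Complex.exp (n * θ * Complex.I) / (n : ℂ) ^ 2)
      ((θ ^ 2 / 2 - Real.pi * θ + Real.pi ^ 2 / 3 : ℝ) : ℂ) := by
  have hpi : (Real.pi : ℂ) ≠ 0 := Complex.ofReal_ne_zero.2 Real.pi_ne_zero
  have h := hasSum_one_div_pow_mul_fourier_mul_bernoulliFun le_rfl (x := θ / (2 * Real.pi))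
    ⟨by positivity, (div_le_one (by positivity)).2 h1⟩
  convert h using 1
  · funext n
    rw [fourier_coe_apply, div_eq_mul_one_div, mul_comm]
    congr 2
    push_cast
    field_simp
  · rw [bernoulliFun_two]
    push_cast
    rw [mul_pow, Complex.I_sq]
    simp [Nat.factorial]
    field_simp
    ring

/-- The factor 2 - 2 cos(nδ) takes minus a second difference of step δ. Off the bump all three
points lie in one period, where the sum is a quadratic with leading coefficient 1/2, so this
difference is -δ²; the coefficient δ² at n = 0 cancels it. -/
theorem hasSum_bumpCoeff {δ θ : ℝ} (h0 : 0 ≤ δ) (h1 : δ ≤ θ) (h2 : θ ≤ 2 * Real.pi - δ) :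
    HasSum (fun n : ℤ => (bumpCoeff δ n : ℂ) * Complex.exp (n * θ * Complex.I)) 0 := by
  have hA := (hasSum_exp_div_sq (θ := θ) (by linarith) (by linarith)).mul_left 2
  have hB := hasSum_exp_div_sq (θ := θ + δ) (by linarith) (by linarith)
  have hC := hasSum_exp_div_sq (θ := θ - δ) (by linarith) (by linarith)
  have hD := hasSum_ite_eq (0 : ℤ) ((δ : ℂ) ^ 2)
  have hS := ((hA.sub hB).sub hC).add hD
  rw [show (2 * ((θ ^ 2 / 2 - Real.pi * θ + Real.pi ^ 2 / 3 : ℝ) : ℂ) -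
      (((θ + δ) ^ 2 / 2 - Real.pi * (θ + δ) + Real.pi ^ 2 / 3 : ℝ) : ℂ) -
      (((θ - δ) ^ 2 / 2 - Real.pi * (θ - δ) + Real.pi ^ 2 / 3 : ℝ) : ℂ) + (δ : ℂ) ^ 2) = 0 by
    push_cast; ring] at hS
  refine (congrArg (HasSum · (0 : ℂ)) (funext fun n : ℤ => ?_)).mpr hS
  have e1 : Complex.exp (n * (θ + δ : ℝ) * Complex.I) =
      Complex.exp (n * θ * Complex.I) * Complex.exp (n * δ * Complex.I) := by
    rw [← Complex.exp_add]; push_cast; ring_nf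
  have e2 : Complex.exp (n * (θ - δ : ℝ) * Complex.I) =
      Complex.exp (n * θ * Complex.I) * Complex.exp (-(n * δ) * Complex.I) := by
    rw [← Complex.exp_add]; push_cast; ring_nf
  rw [e1, e2, bumpCoeff]
  push_cast
  rw [Complex.two_cos]
  split_ifs with hn
  · simp [hn]
  · rw [Complex.ofReal_zero]; ring

theorem hasSum_bumpCoeff_circle {δ : ℝ} (h0 : 0 ≤ δ) {u : Circle} (hu : δ ≤ |Complex.arg u|) :
    HasSum (fun n : ℤ => (bumpCoeff δ n : ℂ) * (u : ℂ) ^ n) 0 := by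
  have hpi := Complex.arg_le_pi u
  have hpi' := Complex.neg_pi_lt_arg u
  have key : ∀ θ : ℝ, Circle.exp θ = u → δ ≤ θ → θ ≤ 2 * Real.pi - δ →
      HasSum (fun n : ℤ => (bumpCoeff δ n : ℂ) * (u : ℂ) ^ n) 0 := fun θ hθ h1 h2 => by
    convert hasSum_bumpCoeff h0 h1 h2 using 3 with n
    rw [← hθ, Circle.coe_exp, ← Complex.exp_int_mul, mul_assoc]
  rcases le_abs.1 hu with h | h
  · exact key _ (Circle.exp_arg u) h (by linarith)
  · refine key (Complex.arg u + 2 * Real.pi) ?_ (by linarith) (by linarith)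
    rw [Circle.exp_add_two_pi, Circle.exp_arg]

/-! ### Beurling's theorem for measures carried by the integers. -/

theorem sum_Ico_div_sq_le {w : ℕ → ℝ} (hw0 : ∀ n, 1 ≤ n → 0 < w n)
    (hw : ∀ m n, 1 ≤ m → m ≤ n → w m ≤ w n) (K : ℕ) :
    ∑ n ∈ Finset.Ico 1 (480 ^ K), w n / (n : ℝ) ^ 2 ≤
      ∑ k ∈ Finset.range K, 480 ^ 2 * (w (480 ^ (k + 1)) / 480 ^ (k + 1)) := by
  induction K with
  | zero => simp
  | succ K ih =>
    rw [Finset.sum_range_succ, ← Finset.sum_Ico_consecutive _ (Nat.one_le_pow' K 479)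
      (Nat.pow_le_pow_right (by norm_num) K.le_succ)]
    refine add_le_add ih ((Finset.sum_le_card_nsmul _ _
      (w (480 ^ (K + 1)) / (480 ^ K) ^ 2) fun n hn => ?_).trans ?_)
    · rw [Finset.mem_Ico] at hn
      have h1 : 1 ≤ n := (Nat.one_le_pow' K 479).trans hn.1
      have h2 : (480 : ℝ) ^ K ≤ n := by exact_mod_cast hn.1
      exact div_le_div₀ (hw0 _ (Nat.one_le_pow' _ 479)).le (hw _ _ h1 hn.2.le) (by positivity)
        (pow_le_pow_left₀ (by positivity) h2 2)
    · rw [Nat.card_Ico, nsmul_eq_mul]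
      have hpos := hw0 _ (Nat.one_le_pow' (K + 1) 479)
      have hc : ((480 ^ (K + 1) - 480 ^ K : ℕ) : ℝ) ≤ 480 ^ (K + 1) := by
        exact_mod_cast Nat.sub_le _ _
      refine (mul_le_mul_of_nonneg_right hc (by positivity)).trans (le_of_eq ?_)
      field_simp
      ring

theorem not_summable_of_tendsto_sum_div_sq {w : ℕ → ℝ} (hw0 : ∀ n, 1 ≤ n → 0 < w n)
    (hw : ∀ m n, 1 ≤ m → m ≤ n → w m ≤ w n)
    (hdiv : Tendsto (fun N : ℕ => ∑ n ∈ Finset.Icc 1 N, w n / (n : ℝ) ^ 2) atTop atTop) :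
    ¬Summable fun k : ℕ => w (480 ^ k) / 480 ^ k := by
  intro hs
  have hs' := ((summable_nat_add_iff 1).2 hs).mul_left (480 ^ 2)
  obtain ⟨N, hN⟩ := (hdiv.eventually (eventually_gt_atTop
    (∑' k : ℕ, 480 ^ 2 * (w (480 ^ (k + 1)) / 480 ^ (k + 1))))).exists
  refine absurd hN (not_lt.2 ?_)
  have hnn : ∀ n : ℕ, 1 ≤ n → 0 ≤ w n / (n : ℝ) ^ 2 := fun n hn =>
    div_nonneg (hw0 n hn).le (sq_nonneg _)
  calc ∑ n ∈ Finset.Icc 1 N, w n / (n : ℝ) ^ 2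
      ≤ ∑ n ∈ Finset.Ico 1 (480 ^ N), w n / (n : ℝ) ^ 2 := by
        refine Finset.sum_le_sum_of_subset_of_nonneg (fun n hn => ?_)
          fun n hn _ => hnn n (Finset.mem_Ico.1 hn).1
        rw [Finset.mem_Icc] at hn
        exact Finset.mem_Ico.2 ⟨hn.1, hn.2.trans_lt (Nat.lt_pow_self (by norm_num))⟩
    _ ≤ _ := sum_Ico_div_sq_le hw0 hw N
    _ ≤ _ := hs'.sum_le_tsum _ fun k _ =>
        mul_nonneg (by norm_num) (div_nonneg (hw0 _ (Nat.one_le_pow' _ 479)).le (by positivity))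

/-- The sum of point masses `‖a n‖` at the integers. -/
noncomputable def intMeasure (a : ℤ → ℂ) : Measure ℝ :=
  Measure.sum fun n : ℤ => ENNReal.ofReal ‖a n‖ • Measure.dirac (n : ℝ)

theorem intMeasure_apply (a : ℤ → ℂ) {s : Set ℝ} (hs : MeasurableSet s) :
    intMeasure a s = ∑' n : ℤ, ENNReal.ofReal ‖a n‖ * s.indicator 1 (n : ℝ) := by
  rw [intMeasure, Measure.sum_apply _ hs]
  simp [Measure.dirac_apply' _ hs]

theorem isFiniteMeasure_intMeasure {a : ℤ → ℂ} (ha : Summable fun n => ‖a n‖) :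
    IsFiniteMeasure (intMeasure a) := by
  refine ⟨?_⟩
  rw [intMeasure_apply a MeasurableSet.univ]
  simpa using ha.tsum_ofReal_lt_top

/-- A function on the line whose value at an integer `n` is the phase of `a n`. -/
noncomputable def intPhase (a : ℤ → ℂ) (x : ℝ) : ℂ := a ⌊x⌋ / ‖a ⌊x⌋‖

theorem measurable_intPhase (a : ℤ → ℂ) : Measurable (intPhase a) :=
  (measurable_of_countable fun n : ℤ => a n / ‖a n‖).comp Int.measurable_floor

theorem norm_intPhase_le_one (a : ℤ → ℂ) (x : ℝ) : ‖intPhase a x‖ ≤ 1 := by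
  rw [intPhase, norm_div, Complex.norm_real, norm_norm]
  exact div_self_le_one _

theorem norm_mul_intPhase (a : ℤ → ℂ) (n : ℤ) : ‖a n‖ * intPhase a n = a n := by
  rw [intPhase, Int.floor_intCast]
  rcases eq_or_ne (a n) 0 with h | h
  · simp [h]
  · exact mul_div_cancel₀ _ (by simpa using h)

theorem hasSum_integral_intMeasure {a : ℤ → ℂ} (ha : Summable fun n => ‖a n‖) (ξ : ℝ) :
    HasSum (fun n : ℤ => a n * Complex.exp (-(Complex.I * n * ξ)))
      (∫ t : ℝ, Complex.exp (-(Complex.I * t * ξ)) * intPhase a t ∂(intMeasure a)) := by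
  have hfin := isFiniteMeasure_intMeasure ha
  have hmeas : Measurable fun t : ℝ => Complex.exp (-(Complex.I * t * ξ)) * intPhase a t :=
    Measurable.mul (by fun_prop) (measurable_intPhase a)
  have hint : Integrable (fun t : ℝ => Complex.exp (-(Complex.I * t * ξ)) * intPhase a t)
      (intMeasure a) := by
    refine Integrable.of_bound hmeas.aestronglyMeasurable 1 (Eventually.of_forall fun t => ?_)
    rw [norm_mul]
    refine mul_le_one₀ (by simp [Complex.norm_exp]) (norm_nonneg _) (norm_intPhase_le_one a t)
  have h := hasSum_integral_measure hint
  refine (congrArg (HasSum · _) (funext fun n : ℤ => ?_)).mpr h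
  rw [integral_smul_measure, integral_dirac, ENNReal.toReal_ofReal (norm_nonneg _),
    Complex.real_smul, mul_left_comm, norm_mul_intPhase, mul_comm, Complex.ofReal_intCast]

/-- A summable trigonometric series with coefficients decaying fast on one side and vanishing on
a set of positive measure has vanishing coefficients. -/
theorem coeff_eq_zero_of_decay {w : ℕ → ℝ} (hw0 : ∀ n, 1 ≤ n → 0 < w n)
    (hw : ∀ m n, 1 ≤ m → m ≤ n → w m ≤ w n)
    (hdiv : Tendsto (fun N : ℕ => ∑ n ∈ Finset.Icc 1 N, w n / (n : ℝ) ^ 2) atTop atTop)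
    {a : ℤ → ℂ} {s : ℤ → ℝ} (hs : Summable s) (has : ∀ n, ‖a n‖ ≤ s n)
    (haw : ∀ n : ℕ, 1 ≤ n → ‖a n‖ ≤ s n * Real.exp (-w n))
    {E : Set ℝ} (hE : MeasurableSet E) (hpos : 0 < volume E)
    (hFE : ∀ ξ ∈ E, HasSum (fun n : ℤ => a n * Complex.exp (-(Complex.I * n * ξ))) 0) (n : ℤ) :
    a n = 0 := by
  have ha : Summable fun n => ‖a n‖ := Summable.of_nonneg_of_le (fun _ => norm_nonneg _) has hs
  have hs0 : ∀ n, 0 ≤ s n := fun n => (norm_nonneg _).trans (has n)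
  have hfin := isFiniteMeasure_intMeasure ha
  have htail : ∀ k : ℕ, (intMeasure a).real (Ici (480 ^ k : ℝ)) ≤
      (∑' n, s n) * Real.exp (-w (480 ^ k)) := fun k => by
    refine ENNReal.toReal_le_of_le_ofReal
      (mul_nonneg (tsum_nonneg hs0) (Real.exp_pos _).le) ?_
    rw [intMeasure_apply a measurableSet_Ici, ← tsum_mul_right, ENNReal.ofReal_tsum_of_nonneg
      (fun n => mul_nonneg (hs0 n) (Real.exp_pos _).le) (hs.mul_right _)]
    refine ENNReal.tsum_le_tsum fun n => ?_
    by_cases hn : (n : ℝ) ∈ Ici (480 ^ k : ℝ)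
    · rw [indicator_of_mem hn, Pi.one_apply, mul_one]
      have hn' : (480 : ℤ) ^ k ≤ n := by exact_mod_cast mem_Ici.1 hn
      obtain ⟨m, rfl⟩ := Int.eq_ofNat_of_zero_le ((by positivity : (0 : ℤ) ≤ 480 ^ k).trans hn')
      have hm : 480 ^ k ≤ m := by exact_mod_cast hn'
      have h1 := Nat.one_le_pow' k 479
      exact ENNReal.ofReal_le_ofReal ((haw m (h1.trans hm)).trans (mul_le_mul_of_nonneg_left
        (Real.exp_le_exp.2 (neg_le_neg (hw _ _ h1 hm))) (hs0 _)))
    · rw [indicator_of_notMem hn, mul_zero]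
      exact zero_le
  have hzero := integral_eq_zero_of_tail (measurable_intPhase a) (norm_intPhase_le_one a)
    (w := fun k => w (480 ^ k))
    (fun i j hij => hw _ _ (Nat.one_le_pow' i 479) (Nat.pow_le_pow_right (by norm_num) hij))
    (fun k => (hw0 _ (Nat.one_le_pow' k 479)).le)
    (not_summable_of_tendsto_sum_div_sq hw0 hw hdiv) htail hE hpos
    (fun ξ hξ => (hasSum_integral_intMeasure ha ξ).unique (hFE ξ hξ))
  have hae := ae_eq_zero_of_fourier_real_eq_zero (measurable_intPhase a) (norm_intPhase_le_one a)
    hzero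
  by_contra hn
  have h1 := Measure.ae_sum_iff.1 hae n
  rw [Measure.ae_ennreal_smul_measure_iff (by simpa using hn)] at h1
  have h2 : intPhase a n = 0 :=
    (ae_dirac_iff (p := fun x => intPhase a x = 0)
      (measurable_intPhase a (measurableSet_singleton 0))).1 h1
  have h3 := norm_mul_intPhase a n
  rw [h2, mul_zero] at h3
  exact hn h3.symm

/-! ### The Cartwright–Levinson theorem. -/

theorem exists_arg_bound {U : Set Circle} (hU : IsOpen U) (hne : U.Nonempty) :
    ∃ ξ₀ : ℝ, ∃ ε > 0, ∀ δ ≤ ε, ∀ ξ ∈ Metric.ball ξ₀ ε, ∀ ζ ∉ U,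
      δ ≤ |Complex.arg (ζ * Circle.exp (-ξ) : Circle)| := by
  obtain ⟨z, hz⟩ := hne
  have hz' : Complex.arg z ∈ Circle.exp ⁻¹' U := by rwa [mem_preimage, Circle.exp_arg]
  obtain ⟨ε, hε, hball⟩ := Metric.isOpen_iff.1 (hU.preimage Circle.exp.continuous) _ hz'
  refine ⟨Complex.arg z, ε / 2, half_pos hε, fun δ hδ ξ hξ ζ hζ => ?_⟩
  by_contra! h
  refine hζ ?_
  have h1 : Complex.arg (ζ * Circle.exp (-ξ) : Circle) + ξ ∈ Metric.ball (Complex.arg z) ε := by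
    rw [Metric.mem_ball, Real.dist_eq] at hξ ⊢
    calc |Complex.arg (ζ * Circle.exp (-ξ) : Circle) + ξ - Complex.arg z|
        ≤ |Complex.arg (ζ * Circle.exp (-ξ) : Circle)| + |ξ - Complex.arg z| := by
          rw [add_sub_assoc]; exact abs_add_le _ _
      _ < ε := by linarith
  have h2 := hball h1
  rw [mem_preimage, Circle.exp_add, Circle.exp_arg, mul_assoc, ← Circle.exp_add, neg_add_cancel,
    Circle.exp_zero, mul_one] at h2
  exact h2

theorem exists_bound_of_eventually {c : ℕ → ℝ} {w : ℕ → ℝ} {C m : ℝ}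
    (hw : ∀ m n, 1 ≤ m → m ≤ n → w m ≤ w n) (hm : ∀ n, c n ≤ m) (hm0 : 0 ≤ m)
    (hc : ∀ᶠ n in atTop, c n ≤ C * Real.exp (-w n)) :
    ∃ C' ≥ m, ∀ n, 1 ≤ n → c n ≤ C' * Real.exp (-w n) := by
  obtain ⟨N, hN⟩ := eventually_atTop.1 hc
  refine ⟨|C| + m * Real.exp (w N) + m, ?_, fun n hn => ?_⟩
  · have : 0 ≤ m * Real.exp (w N) := by positivity
    linarith [abs_nonneg C]
  · have hexp := Real.exp_pos (-w n)
    rcases le_or_gt N n with h | h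
    · refine (hN n h).trans (mul_le_mul_of_nonneg_right ?_ hexp.le)
      have : 0 ≤ m * Real.exp (w N) := by positivity
      linarith [le_abs_self C]
    · calc c n ≤ m * 1 := by rw [mul_one]; exact hm n
        _ ≤ m * Real.exp (w N + -w n) := by
          refine mul_le_mul_of_nonneg_left (Real.one_le_exp ?_) hm0
          linarith [hw n N hn h.le]
        _ = m * Real.exp (w N) * Real.exp (-w n) := by rw [Real.exp_add, mul_assoc]
        _ ≤ _ := mul_le_mul_of_nonneg_right (by linarith [abs_nonneg C]) hexp.le

/-- Smoothing by the bump makes the moment series absolutely convergent and zero for ξ in an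
interval. The map φ allows both directions of decay: the identity for n → -∞ and inversion for n →
+∞. -/
theorem moment_eq_zero {X : Type*} [MeasurableSpace X] {ν : Measure X} [IsFiniteMeasure ν]
    {φ : X → Circle} (hφ : Measurable φ) {h : X → ℂ} (hm : Measurable h) (hb : ∀ x, ‖h x‖ ≤ 1)
    {U : Set Circle} (hU : IsOpen U) (hne : U.Nonempty) (hφU : ∀ᵐ x ∂ν, φ x ∉ U)
    {w : ℕ → ℝ} (hw0 : ∀ n, 1 ≤ n → 0 < w n) (hw : ∀ m n, 1 ≤ m → m ≤ n → w m ≤ w n)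
    (hdiv : Tendsto (fun N : ℕ => ∑ n ∈ Finset.Icc 1 N, w n / (n : ℝ) ^ 2) atTop atTop)
    {C : ℝ} (hc : ∀ᶠ n : ℕ in atTop,
      ‖∫ x, (φ x : ℂ) ^ (n : ℤ) * h x ∂ν‖ ≤ C * Real.exp (-w n)) (n : ℤ) :
    ∫ x, (φ x : ℂ) ^ n * h x ∂ν = 0 := by
  set c : ℤ → ℂ := fun n => ∫ x, (φ x : ℂ) ^ n * h x ∂ν with hcdef
  have hφm : ∀ n : ℤ, Measurable fun x => (φ x : ℂ) ^ n := fun n =>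
    (continuous_circle_zpow n).measurable.comp hφ
  have hnorm : ∀ (n : ℤ) x, ‖(φ x : ℂ) ^ n * h x‖ ≤ 1 := fun n x => by
    rw [norm_mul, norm_zpow, Circle.norm_coe, one_zpow, one_mul]; exact hb x
  have hint : ∀ n : ℤ, Integrable (fun x => (φ x : ℂ) ^ n * h x) ν := fun n =>
    Integrable.of_bound ((hφm n).mul hm).aestronglyMeasurable 1 (Eventually.of_forall (hnorm n))
  have hcm : ∀ n, ‖c n‖ ≤ ν.real univ := fun n => by
    simpa using norm_integral_le_of_norm_le_const (Eventually.of_forall (hnorm n)) (μ := ν)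
  obtain ⟨C', hC', hcC⟩ := exists_bound_of_eventually (c := fun n : ℕ => ‖c n‖) hw
    (fun n => hcm n) measureReal_nonneg hc
  obtain ⟨ξ₀, ε, hε, harg⟩ := exists_arg_bound hU hne
  -- The bump depends on n: |n|δ < 1 ensures that its n-th coefficient is not zero and can be
  -- divided out.
  set δ := min ε (1 / (|(n : ℝ)| + 1)) with hδ
  have hδpos : 0 < δ := lt_min hε (by positivity)
  have hδn : |(n : ℝ)| * δ < 1 :=
    calc |(n : ℝ)| * δ ≤ |(n : ℝ)| * (1 / (|(n : ℝ)| + 1)) :=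
          mul_le_mul_of_nonneg_left (min_le_right _ _) (abs_nonneg _)
      _ < 1 := by rw [mul_one_div, div_lt_one (by positivity)]; linarith
  have hκ := bumpCoeff_nonneg δ
  have hκn : ∀ n, ‖(bumpCoeff δ n : ℂ)‖ = bumpCoeff δ n := fun n => by
    rw [Complex.norm_real, Real.norm_of_nonneg (hκ n)]
  have hzero := coeff_eq_zero_of_decay hw0 hw hdiv (a := fun n => bumpCoeff δ n * c n)
    ((summable_bumpCoeff δ).mul_left C') (fun n => ?_) (fun n hn => ?_)
    (Metric.isOpen_ball.measurableSet) (Metric.measure_ball_pos volume ξ₀ hε) (fun ξ hξ => ?_) n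
  · refine (mul_eq_zero.1 hzero).resolve_left ?_
    exact_mod_cast (bumpCoeff_pos hδpos hδn).ne'
  · rw [norm_mul, hκn, mul_comm]
    exact mul_le_mul_of_nonneg_right ((hcm n).trans hC') (hκ n)
  · rw [norm_mul, hκn, mul_comm, mul_right_comm]
    exact mul_le_mul_of_nonneg_right (hcC n hn) (hκ n)
  · have hF := hasSum_integral_of_summable_integral_norm (μ := ν)
      (F := fun (n : ℤ) x => (bumpCoeff δ n * Complex.exp (-(Complex.I * n * ξ))) *
        ((φ x : ℂ) ^ n * h x)) (fun n => (hint n).const_mul _) ?_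
    · have h0 : ∫ x, ∑' n : ℤ, (bumpCoeff δ n * Complex.exp (-(Complex.I * n * ξ))) *
          ((φ x : ℂ) ^ n * h x) ∂ν = 0 := by
        refine integral_eq_zero_of_ae ?_
        filter_upwards [hφU] with x hx
        have h1 := (hasSum_bumpCoeff_circle hδpos.le
          (harg δ (min_le_left _ _) ξ hξ _ hx)).mul_right (h x)
        rw [zero_mul] at h1
        rw [Pi.zero_apply, ← h1.tsum_eq]
        refine tsum_congr fun n => ?_
        rw [Circle.coe_mul, mul_zpow, Circle.coe_exp, ← Complex.exp_int_mul]
        push_cast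
        ring_nf
      rw [h0] at hF
      refine (congrArg (HasSum · (0 : ℂ)) (funext fun n : ℤ => ?_)).mpr hF
      rw [integral_const_mul]
      ring
    · refine Summable.of_nonneg_of_le (fun n => integral_nonneg fun x => norm_nonneg _)
        (fun n => ?_) ((summable_bumpCoeff δ).mul_right (ν.real univ))
      have h1 : ∀ x, ‖(bumpCoeff δ n * Complex.exp (-(Complex.I * n * ξ))) *
          ((φ x : ℂ) ^ n * h x)‖ ≤ bumpCoeff δ n := fun x => by
        rw [norm_mul, norm_mul, hκn]
        have h2 : ‖Complex.exp (-(Complex.I * n * ξ))‖ = 1 := by simp [Complex.norm_exp]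
        rw [h2, mul_one]
        exact mul_le_of_le_one_right (hκ n) (hnorm n x)
      have h3 := integral_mono_of_nonneg (μ := ν) (Eventually.of_forall fun x => norm_nonneg _)
        (integrable_const _) (Eventually.of_forall h1)
      refine h3.trans (le_of_eq ?_)
      rw [integral_const, smul_eq_mul, mul_comm]

theorem csupport_eq_univ_of_decay {w : ℕ → ℝ} (hw0 : ∀ n, 1 ≤ n → 0 < w n)
    (hw : ∀ m n, 1 ≤ m → m ≤ n → w m ≤ w n)
    (hdiv : Tendsto (fun N : ℕ => ∑ n ∈ Finset.Icc 1 N, w n / (n : ℝ) ^ 2) atTop atTop)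
    {μ : ComplexMeasure Circle}
    (hμw : (fourierCircle μ =O[atBot] fun n : ℤ => Real.exp (-(w n.natAbs))) ∨
      (fourierCircle μ =O[atTop] fun n : ℤ => Real.exp (-(w n.natAbs)))) (hμ0 : μ ≠ 0) :
    csupport μ = univ := by
  by_contra hsupp
  refine hμ0 ?_
  have hfin := isFiniteMeasure_variation μ
  obtain ⟨z, hz⟩ := (ne_univ_iff_exists_notMem _).1 hsupp
  obtain ⟨V, hV, hV0⟩ := Measure.notMem_support_iff_exists.1 hz
  obtain ⟨U, hUV, hU, hzU⟩ := mem_nhds_iff.1 hV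
  have hU0 : ∀ᵐ ζ ∂(VectorMeasure.variation μ), ζ ∉ U :=
    measure_eq_zero_iff_ae_notMem.1 (measure_mono_null hUV hV0)
  obtain ⟨h, hm, hb, hμ⟩ := exists_density μ
  have hF : ∀ n : ℤ, fourierCircle μ n =
      ∫ ζ : Circle, (ζ : ℂ) ^ (-n) * h ζ ∂(VectorMeasure.variation μ) := fun n => by
    refine cintegral_eq_integral_mul hm hb hμ (Integrable.of_bound
      (continuous_circle_zpow _).measurable.aestronglyMeasurable 1 (Eventually.of_forall fun ζ => ?_))
    rw [norm_zpow, Circle.norm_coe, one_zpow]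
  have hzero : ∀ n : ℤ,
      ∫ ζ : Circle, (ζ : ℂ) ^ (-n) * h ζ ∂(VectorMeasure.variation μ) = 0 := by
    intro n
    rcases hμw with hO | hO
    · obtain ⟨C, hC⟩ := hO.bound
      refine moment_eq_zero (φ := id) measurable_id hm hb hU ⟨z, hzU⟩ hU0 hw0 hw hdiv
        (C := C) ?_ (-n)
      have ht : Tendsto (fun k : ℕ => -(k : ℤ)) atTop atBot :=
        tendsto_neg_atTop_atBot.comp tendsto_natCast_atTop_atTop
      filter_upwards [ht.eventually hC] with k hk
      rw [hF, neg_neg, Int.natAbs_neg, Int.natAbs_natCast, Real.norm_of_nonneg (Real.exp_pos _).le]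
        at hk
      exact hk
    · obtain ⟨C, hC⟩ := hO.bound
      have hinv : ∀ (ζ : Circle) (k : ℤ), ((ζ⁻¹ : Circle) : ℂ) ^ k = (ζ : ℂ) ^ (-k) :=
        fun ζ k => by rw [Circle.coe_inv, inv_zpow, zpow_neg]
      simp_rw [← hinv]
      refine moment_eq_zero (φ := fun ζ => ζ⁻¹) measurable_inv hm hb hU.inv
        (nonempty_inv.2 ⟨z, hzU⟩) (hU0.mono fun ζ hζ => by rwa [Set.inv_mem_inv]) hw0 hw hdiv
        (C := C) ?_ n
      filter_upwards [tendsto_natCast_atTop_atTop.eventually hC] with k hk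
      rw [hF, Int.natAbs_natCast, Real.norm_of_nonneg (Real.exp_pos _).le] at hk
      simp_rw [hinv]
      exact hk
  rw [← hμ, WithDensityᵥEq.congr_ae (ae_eq_zero_of_fourier_circle_eq_zero hm hb hzero),
    withDensityᵥ_zero]

end OneSidedDecay

/-- Beurling's theorem, and the Cartwright-Levinson theorem. The logarithm is the extended one,
`ENNReal.log : ENNReal → EReal`, with `log 0 = -∞`. -/
theorem mainTheorem10 :
    (∀ μ : ComplexMeasure ℝ,
      OneSidedDecay.IntegralEqNegInfty (volume.restrict (Ioi (0 : ℝ)))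
        (fun t : ℝ =>
          ENNReal.log (OneSidedDecay.tailVariation μ t) / (((1 + t ^ 2 : ℝ)) : EReal)) →
      ∀ E : Set ℝ, MeasurableSet E → 0 < volume E →
        (∀ ξ ∈ E, OneSidedDecay.fourierReal μ ξ = 0) → μ = 0) ∧
    (∀ w : ℕ → ℝ,
      (∀ n, 1 ≤ n → 0 < w n) →
      (∀ m n, 1 ≤ m → m ≤ n → w m ≤ w n) →
      Tendsto (fun N : ℕ => ∑ n ∈ Finset.Icc 1 N, w n / (n : ℝ) ^ 2) atTop atTop →
      ∀ μ : ComplexMeasure Circle,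
        ((OneSidedDecay.fourierCircle μ =O[atBot] fun n : ℤ => Real.exp (-(w n.natAbs))) ∨
          (OneSidedDecay.fourierCircle μ =O[atTop] fun n : ℤ => Real.exp (-(w n.natAbs)))) →
        μ ≠ 0 → OneSidedDecay.csupport μ = univ) := by
  refine ⟨fun μ hint E hE hpos hFE => ?_, fun w hw0 hw hdiv μ hμw hμ0 => ?_⟩
  · exact OneSidedDecay.eq_zero_of_log_tailVariation hint.2 hE hpos hFE
  · exact OneSidedDecay.csupport_eq_univ_of_decay hw0 hw hdiv hμw hμ0
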